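/- **Self-stabilizing deterministic naming in trees.** *Model.* Let $G$ be an anonymous network on $n$ nodes (a finite graph whose edges at each node $u$ carry distinct port numbers). Each node has a whiteboard. There are $k\ge 1$ anonymous robots, all running the same deterministic algorithm, which may depend on $k$ but not on the network; the memory of a robot determines an identifier in $[1,k]$. When a robot on a node $u$ is executed, it sees $\deg(u)$, the port by which it arrived at $u$ (if any), the contents of the whiteboard of $u$ and the states of the other robots on $u$; on this basis it rewrites the whiteboard, changes its own state, and stays or leaves by a port of its choice. In each atomic step a distributed adversary activates a nonempty set of nodes that contain robots; on each activated node the algorithm chooses at least one robot to be executed (several chosen robots are executed one after the other, in an order fixed by the adversary, which also breaks ties between robots that look alike), and robots that leave are on the adjacent node at the end of the step. Edges are semi-bidirectional: no edge is traversed in both directions in the same step. The adversary is weakly fair: a node that contains robots forever from some time on is activated again. A round is the shortest time in which every node that contains a robot at the beginning of the round is activated. *Statement.* There is a constant $C$ such that for every $k\ge 1$ there is a deterministic algorithm for $k$ robots with the following properties. A robot uses at most $C\lceil\log_2 k\rceil$ bits of memory. In every tree with $n$ nodes and maximum degree $\Delta$, with any port numbering, each whiteboard uses at most $C\,k\,(\lceil\log_2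 k\rceil+\lceil\log_2\Delta\rceil)$ bits (with $\lceil\log_2 0\rceil$ read as $0$ for the one-node tree). In every execution with semi-bidirectional edges under a distributed weakly fair adversary, starting from an arbitrary configuration (arbitrary robot positions, arrival ports, robot memories and whiteboard contents), after at most $C\,k\,n$ rounds the identifiers of the $k$ robots are pairwise distinct elements of $[1,k]$, and from then on they never change. -/

import Mathlib

/-- An anonymous network: a finite graph in which the edges incident to each node `u` carry
pairwise distinct port numbers (here `0, …, deg u - 1`). -/
structure Network (V : Type*) where
  graph : SimpleGraph V
  port : ∀ u : V, graph.neighborSet u ≃ Fin (graph.neighborSet u).ncard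

namespace Network

variable {V : Type*}

/-- The degree of a node. -/
noncomputable abbrev deg (N : Network V) (u : V) : ℕ := (N.graph.neighborSet u).ncard

/-- The maximum degree `Δ`. -/
noncomputable def maxDeg [Fintype V] (N : Network V) : ℕ := Finset.univ.sup N.deg

/-- The endpoint of the edge that leaves `u` through port `p`. -/
noncomputable def neighbor (N : Network V) (u : V) (p : Fin (N.deg u)) : V := ((N.port u).symm p : V)

open Classical in
/-- The port number, at `u`, of the edge that joins `u` to `w`
(`none` if there is no such edge or no `w`). -/
noncomputable def portTo (N : Network V) (u : V) (w : Option V) : Option (Fin (N.deg u)) :=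
  if h : ∃ x : N.graph.neighborSet u, w = some x then some (N.port u h.choose) else none

end Network

/-- `X` can be stored in `b` bits. -/
def FitsInBits (X : Type) (b : ℕ) : Prop := Finite X ∧ Nat.card X ≤ 2 ^ b

/-- A deterministic algorithm for `k` anonymous mobile robots. It is the same for all robots, and it
does not know the network.

* `State` is the memory of a robot, `Board d` the contents of the whiteboard of a node of degree `d`.
* `ident s` is the identifier, in `[1, k]`, that a robot in state `s` has.
* `code b s q M` is the atomic action of a robot in state `s` on a node of degree `d` whose whiteboard
  contains `b`, where `q` is the port by which the robot arrived (`none` if it has not arrived by an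
  edge) and `M` is the multiset of the states of the other robots on the node. The result is the new
  contents of the whiteboard, the new state of the robot, and the port by which it leaves (`none` if
  it stays).
* `select b L` says which robots of an activated node are executed, where `L` is the multiset of the
  pairs (state, arrival port) of the robots on the node. At least one is. -/
structure RobotAlgorithm (k : ℕ) where
  State : Type
  Board : ℕ → Type
  state_nonempty : Nonempty State
  board_nonempty : ∀ d, Nonempty (Board d)
  ident : State → ℕ
  ident_mem : ∀ s, ident s ∈ Set.Icc 1 k
  code : ∀ {d : ℕ}, Board d → State → Option (Fin d) → Multiset State →
    Board d × State × Option (Fin d)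
  select : ∀ {d : ℕ}, Board d → Multiset (State × Option (Fin d)) →
    Multiset (State × Option (Fin d))
  select_le : ∀ {d : ℕ} (b : Board d) (L : Multiset (State × Option (Fin d))), select b L ≤ L
  select_ne_zero : ∀ {d : ℕ} (b : Board d) (L : Multiset (State × Option (Fin d))),
    L ≠ 0 → select b L ≠ 0

namespace RobotAlgorithm

variable {V : Type*} {k : ℕ} (A : RobotAlgorithm k) (N : Network V)

/-- A configuration. The robot `r` is on the node `pos r`, in state `state r`, and has arrived there
from the adjacent node `src r` (any other value of `src r`, such as `none`, stands for a robot that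
has not arrived by an edge). -/
structure Config where
  pos : Fin k → V
  src : Fin k → Option V
  state : Fin k → A.State
  board : ∀ u : V, A.Board (N.deg u)

variable {A N}

/-- The multiset of pairs (state, arrival port) of the robots of `s`, seen from the node `u`. -/
noncomputable def Config.views (c : Config A N) (u : V) (s : Multiset (Fin k)) :
    Multiset (A.State × Option (Fin (N.deg u))) :=
  s.map fun r => (c.state r, N.portTo u (c.src r))

open Classical in
/-- The robots on the node `u`. -/
noncomputable def Config.robotsAt (c : Config A N) (u : V) : Finset (Fin k) :=
  Finset.univ.filter fun r => c.pos r = u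

/-- A situation on the node `u` in the course of one activation of `u`: the whiteboard of `u`, the
states of the robots, and the ports by which robots have already left `u`. -/
structure Local (A : RobotAlgorithm k) (N : Network V) (u : V) where
  board : A.Board (N.deg u)
  state : Fin k → A.State
  out : Fin k → Option (Fin (N.deg u))

open Classical in
/-- The robot `r` executes its code on the node `u`. It sees the robots that are still on `u`. -/
noncomputable def Config.exec (c : Config A N) (u : V) (l : Local A N u) (r : Fin k) :
    Local A N u :=
  let others := (c.robotsAt u).filter fun x => x ≠ r ∧ l.out x = none
  let res := A.code l.board (l.state r) (N.portTo u (c.src r)) (others.val.map l.state)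
  { board := res.1
    state := Function.update l.state r res.2.1
    out := Function.update l.out r res.2.2 }

/-- The robots of the list `L` execute their code on the node `u`, one after the other. -/
noncomputable def Config.run (c : Config A N) (u : V) (L : List (Fin k)) : Local A N u :=
  L.foldl (c.exec u) { board := c.board u, state := c.state, out := fun _ => none }

/-- The configuration after one atomic step, in which for every node `u` the robots of the list `a u`
are executed in this order (the empty list: `u` is not activated). A robot that leaves its node is on
the neighbouring node at the end of the step. -/
noncomputable def Config.step (c : Config A N) (a : V → List (Fin k)) : Config A N where
  pos r := ((c.run (c.pos r) (a (c.pos r))).out r).elim (c.pos r) (N.neighbor (c.pos r))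
  src r := ((c.run (c.pos r) (a (c.pos r))).out r).elim (c.src r) fun _ => some (c.pos r)
  state r := (c.run (c.pos r) (a (c.pos r))).state r
  board u := (c.run u (a u)).board

/-- The choices that the distributed adversary may make in the configuration `c`. It activates a
nonempty set of nodes that contain robots. On each of them the robots to be executed are those that
the algorithm selects; the adversary only orders them, and only breaks ties between robots that look
alike. Since edges are semi-bidirectional, no edge is traversed in both directions in the step. -/
structure Config.Admissible (c : Config A N) (a : V → List (Fin k)) : Prop where
  nonempty : ∃ u, a u ≠ []
  mem : ∀ u, ∀ r ∈ a u, c.pos r = u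
  nodup : ∀ u, (a u).Nodup
  selected : ∀ u, a u ≠ [] → c.views u (a u) = A.select (c.board u) (c.views u (c.robotsAt u).val)
  semiBidirectional : ∀ r r', (c.step a).pos r = c.pos r' → (c.step a).pos r' = c.pos r →
    c.pos r = c.pos r'

variable (A N)

/-- An execution under a distributed, weakly fair adversary, from an arbitrary initial
configuration. -/
structure Execution where
  config : ℕ → Config A N
  act : ℕ → V → List (Fin k)
  admissible : ∀ t, (config t).Admissible (act t)
  step_eq : ∀ t, config (t + 1) = (config t).step (act t)
  /-- A node that contains a robot at all times from `t` on is activated at some time from `t` on. -/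
  weaklyFair : ∀ u t, (∀ t' ≥ t, ∃ r, (config t').pos r = u) → ∃ t' ≥ t, act t' u ≠ []

variable {A N}

/-- `e.RoundsEnd m t`: the first `m` rounds of the execution `e` are over exactly at time `t`. A round
is the shortest time in which all nodes that contain a robot at its beginning are activated. -/
inductive Execution.RoundsEnd (e : Execution A N) : ℕ → ℕ → Prop
  | zero : RoundsEnd e 0 0
  | succ {m t t' : ℕ} : RoundsEnd e m t →
      IsLeast {x | ∀ r, ∃ s, t ≤ s ∧ s < x ∧ e.act s ((e.config t).pos r) ≠ []} t' →
      RoundsEnd e (m + 1) t'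

/-- The identifier of the robot `r` at time `t`. -/
def Execution.ident (e : Execution A N) (t : ℕ) (r : Fin k) : ℕ := A.ident ((e.config t).state r)

/-- The naming specification holds at time `t`: the `k` robots have pairwise distinct identifiers
in `[1, k]`. -/
def Execution.Naming (e : Execution A N) (t : ℕ) : Prop :=
  Function.Injective (e.ident t) ∧ ∀ r, e.ident t r ∈ Set.Icc 1 k

end RobotAlgorithm

/-!
# Self-stabilizing deterministic naming in trees

Every robot with identifier `i` moves through the tree and leaves, on the whiteboard of each node,
the port by which a robot with identifier `i` left it most recently: the *arrow* of the node for
`i`. When a robot is executed on a node where it sees another one with its own identifier, it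
changes to the cyclically next identifier. The other one keeps its identifier at this moment, so an
identifier that is in use remains in use, whatever the whiteboards contain at the beginning.

*Robots with the same identifier meet within `O(n)` rounds* (`TokenRun.not_two_tokens`). In a tree,
a robot that left a node comes back through the edge by which it left. If a robot arrives at a node
whose arrow does not point back to where it comes from, then the arrow is corrupted or belongs to
another robot with the same identifier, and the robot follows the arrows. If they lead to another
robot, then they continue to do so (`TokenRun.lead_succ`), because that robot can only come back
along the path of arrows, and edges are semi-bidirectional. The pursuer never turns back, and the
part of the tree in front of it shrinks with each move: it meets somebody within `n` rounds
(`TokenRun.not_chase`).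

As long as nobody pursues a robot, the nodes visited by a robot `A` belong to `A` alone, for
another robot that enters this territory would be led to `A` (`TokenRun.territory`). On the other
hand, `A` visits the whole tree within `O(n)` moves, which is a contradiction if there are two
robots. Indeed, `A` follows an Euler tour, where each node is left by the port after the one by
which it was entered (`SimpleGraph.IsTree.exists_turn_eq`). The tour is interrupted by excursions
along corrupted arrows. At the end of such a path of arrows the robot goes back to where it left
the tour, using the ports `ret` that it has stored on the way, and continues the tour there. The
way back is essential: if the tour were continued at the end of the arrows, it would skip parts of
the tree, and `A` could need a quadratic number of moves. Since an excursion leads through nodes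
not visited before, the excursions cost at most two moves per node (`TokenRun.Phase`). Corrupted
memory and `ret` ports delay this by `O(n)` moves (`TokenRun.exists_proper`).

*`O(k)` phases of `O(n)` rounds suffice.* In each phase, every identifier that several robots have
at the beginning is given up by at least one of them, which takes the next identifier. This is a
parking process on a cycle of length `k`, and all places are taken after `2k` phases
(`exists_parked`). From then on the identifiers are distinct, and nobody changes any more.
-/

/-! ### Trees: the two sides of an edge, and the Euler tour -/

namespace SimpleGraph

variable {V : Type*} {G : SimpleGraph V} {x y z w w' : V}

/-- The component of `y` that is left when the edge `xy` is deleted from `G`. -/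
def side (G : SimpleGraph V) (x y : V) : Set V :=
  {w | (G.deleteEdges {s(x, y)}).Reachable w y}

theorem mem_side_self : y ∈ G.side x y := Reachable.refl _

theorem IsAcyclic.left_notMem_side (hG : G.IsAcyclic) (h : G.Adj x y) : x ∉ G.side x y :=
  isAcyclic_iff_forall_adj_isBridge.1 hG h

theorem mem_side_of_adj (hw : w ∈ G.side x y) (h : G.Adj w w') (hne : s(w, w') ≠ s(x, y)) :
    w' ∈ G.side x y := by
  refine Reachable.trans (Adj.reachable ?_) hw
  rw [deleteEdges_adj]
  exact ⟨h.symm, by rwa [Set.mem_singleton_iff, Sym2.eq_swap]⟩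

/-- The edge `xy` is the only way out of `G.side x y`. -/
theorem IsAcyclic.eq_of_notMem_side (hG : G.IsAcyclic) (hxy : G.Adj x y) (hw : w ∈ G.side x y)
    (h : G.Adj w w') (hw' : w' ∉ G.side x y) : w = y ∧ w' = x := by
  by_cases hne : s(w, w') = s(x, y)
  · rcases Sym2.eq_iff.1 hne with ⟨rfl, rfl⟩ | h
    · exact absurd hw (hG.left_notMem_side hxy)
    · exact h
  · exact absurd (mem_side_of_adj hw h hne) hw'

theorem IsAcyclic.eq_of_mem_side (hG : G.IsAcyclic) (hxy : G.Adj x y) (hxz : G.Adj x z)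
    (hz : z ∈ G.side x y) : z = y :=
  (hG.eq_of_notMem_side hxy hz hxz.symm (hG.left_notMem_side hxy)).1

theorem IsAcyclic.side_ssubset (hG : G.IsAcyclic) (hxy : G.Adj x y) (hyz : G.Adj y z)
    (hne : z ≠ x) : G.side y z ⊂ G.side x y := by
  refine (Set.ssubset_iff_of_subset ?_).2
    ⟨y, mem_side_self, hG.left_notMem_side hyz⟩
  intro w hw
  have hw' : Relation.ReflTransGen (G.deleteEdges {s(y, z)}).Adj z w :=
    (reachable_iff_reflTransGen _ _).1 (Reachable.symm hw)
  suffices h : w ∈ G.side x y ∧ w ∈ G.side y z from h.1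
  clear hw
  induction hw' with
  | refl =>
    refine ⟨mem_side_of_adj mem_side_self hyz ?_, mem_side_self⟩
    rw [Ne, Sym2.eq_iff]
    rintro (⟨rfl, -⟩ | ⟨-, rfl⟩)
    · exact hxy.ne rfl
    · exact hne rfl
  | @tail u v _ huv ih =>
    rw [deleteEdges_adj, Set.mem_singleton_iff] at huv
    have hv : v ∈ G.side y z := mem_side_of_adj ih.2 huv.1 huv.2
    refine ⟨?_, hv⟩
    by_contra hv'
    obtain ⟨rfl, -⟩ := hG.eq_of_notMem_side hxy ih.1 huv.1 hv'
    exact hG.left_notMem_side hyz ih.2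

/-- The walk that leaves every vertex `x` by the neighbour `nxt x q` that follows the neighbour `q`
it came from. It is a map on the pairs (previous vertex, current vertex). -/
def turn (nxt : V → V → V) (d : V × V) : V × V := (d.2, nxt d.2 d.1)

/-- `nxt x` is a cyclic order on the neighbours of `x`. -/
structure IsRotation (G : SimpleGraph V) (nxt : V → V → V) : Prop where
  adj : ∀ {x q}, G.Adj x q → G.Adj x (nxt x q)
  inj : ∀ {x q q'}, G.Adj x q → G.Adj x q' → nxt x q = nxt x q' → q = q'
  cyclic : ∀ {x q p}, G.Adj x q → G.Adj x p → ∃ j, (nxt x)^[j] q = p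

variable {nxt : V → V → V}

theorem IsRotation.turn_adj (h : G.IsRotation nxt) {d : V × V} (hd : G.Adj d.1 d.2) (i : ℕ) :
    G.Adj ((turn nxt)^[i] d).1 ((turn nxt)^[i] d).2 := by
  induction i with
  | zero => exact hd
  | succ i ih =>
    rw [Function.iterate_succ_apply']
    exact h.adj ih.symm

/-- In a tree, the walk `turn` starting from any dart is an Euler tour: every vertex is reached
within `2 (n - 1)` steps. -/
theorem IsTree.exists_turn_eq [Fintype V] (hG : G.IsTree) (h : G.IsRotation nxt) {d : V × V}
    (hd : G.Adj d.1 d.2) (b : V) : ∃ i < 2 * Fintype.card V, ((turn nxt)^[i] d).2 = b := by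
  classical
  let D := {d : V × V // G.Adj d.1 d.2}
  let f : D → D := fun d => ⟨turn nxt d.1, h.adj d.2.symm⟩
  have hf : Function.Injective f := by
    rintro ⟨⟨q, x⟩, hq⟩ ⟨⟨q', x'⟩, hq'⟩ he
    have he' : (x, nxt x q) = (x', nxt x' q') := congrArg Subtype.val he
    rw [Prod.mk.injEq] at he'
    obtain ⟨rfl, he'⟩ := he'
    have := h.inj hq.symm hq'.symm he'
    subst this; rfl
  have hfi : ∀ i (e : D), (f^[i] e).1 = (turn nxt)^[i] e.1 := by
    intro i e
    induction i with
    | zero => rfl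
    | succ i ih => rw [Function.iterate_succ_apply', Function.iterate_succ_apply', ← ih]
  have hper : ∀ e : D, ∃ p, 0 < p ∧ p ≤ Fintype.card D ∧ f^[p] e = e := by
    intro e
    obtain ⟨i, j, hij, he⟩ := Fintype.exists_ne_map_eq_of_card_lt
      (fun i : Fin (Fintype.card D + 1) => f^[i] e) (by simp)
    wlog hlt : i < j generalizing i j
    · exact this j i hij.symm he.symm (lt_of_le_of_ne (not_lt.1 hlt) hij.symm)
    have hlt' : (i : ℕ) < j := hlt
    refine ⟨j - i, by omega, by omega, ?_⟩
    apply (hf.iterate i)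
    rw [← Function.iterate_add_apply, Nat.add_sub_cancel' hlt'.le]
    exact he.symm
  have hcard : Fintype.card D ≤ 2 * Fintype.card V := by
    have h1 : Fintype.card D ≤ Fintype.card G.Dart :=
      Fintype.card_le_of_injective (fun d : D => (⟨d.1, d.2⟩ : G.Dart)) fun a b hab => by
        exact Subtype.ext (congrArg Dart.toProd hab)
    have h2 := G.dart_card_eq_twice_card_edges
    have h3 := hG.card_edgeFinset
    omega
  -- the darts of the orbit; the orbit is closed under `turn` and under reversal
  let O : Set (V × V) := {e | ∃ i, (turn nxt)^[i] d = e}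
  have hOadj : ∀ e ∈ O, G.Adj e.1 e.2 := by
    rintro _ ⟨i, rfl⟩; exact h.turn_adj hd i
  have hOturn : ∀ e ∈ O, turn nxt e ∈ O := by
    rintro _ ⟨i, rfl⟩; exact ⟨i + 1, Function.iterate_succ_apply' _ _ _⟩
  have hOturn' : ∀ e ∈ O, ∀ i, (turn nxt)^[i] e ∈ O := by
    intro e he i
    induction i with
    | zero => exact he
    | succ i ih => rw [Function.iterate_succ_apply']; exact hOturn _ ih
  have hOrev : ∀ x y, (x, y) ∈ O → (y, x) ∈ O := by
    intro x y hxy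
    have hadj : G.Adj x y := hOadj _ hxy
    obtain ⟨p, hp, -, hpe⟩ := hper ⟨(x, y), hadj⟩
    have hpe' : (turn nxt)^[p] (x, y) = (x, y) := by
      rw [← hfi p ⟨(x, y), hadj⟩, hpe]
    -- the orbit has to leave `side x y` before it returns to the dart `(x, y)`
    have hex : ∃ j, ((turn nxt)^[j] (x, y)).2 ∉ G.side x y := by
      refine ⟨p - 1, ?_⟩
      have : ((turn nxt)^[p - 1] (x, y)).2 = x := by
        have h1 : turn nxt ((turn nxt)^[p - 1] (x, y)) = (x, y) := by
          rw [← Function.iterate_succ_apply' (turn nxt), Nat.succ_eq_add_one,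
            Nat.sub_add_cancel hp, hpe']
        exact congrArg Prod.fst h1
      rw [this]
      exact hG.isAcyclic.left_notMem_side hadj
    classical
    obtain ⟨j, hj, hmin⟩ : ∃ j, ((turn nxt)^[j] (x, y)).2 ∉ G.side x y ∧
        ∀ i < j, ((turn nxt)^[i] (x, y)).2 ∈ G.side x y :=
      ⟨Nat.find hex, Nat.find_spec hex, fun i hi => not_not.1 (Nat.find_min hex hi)⟩
    obtain _ | j := j
    · exact absurd mem_side_self hj
    have h1 := hmin j (Nat.lt_succ_self j)
    have h2 := h.turn_adj (d := (x, y)) hadj (j + 1)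
    have h3 : ((turn nxt)^[j + 1] (x, y)).1 = ((turn nxt)^[j] (x, y)).2 := by
      rw [Function.iterate_succ_apply']; rfl
    rw [← h3] at h1
    obtain ⟨h4, h5⟩ := hG.isAcyclic.eq_of_notMem_side hadj h1 h2 hj
    have : (turn nxt)^[j + 1] (x, y) = (y, x) := Prod.ext h4 h5
    rw [← this]
    exact hOturn' _ hxy _
  -- all darts at a vertex of the orbit are in the orbit
  have hall : ∀ x q p, (q, x) ∈ O → G.Adj p x → (p, x) ∈ O := by
    intro x q p hq hp
    obtain ⟨j, rfl⟩ := h.cyclic (hOadj _ hq).symm hp.symm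
    clear hp
    induction j with
    | zero => exact hq
    | succ j ih =>
      rw [Function.iterate_succ_apply']
      exact hOrev _ _ (hOturn _ ih)
  have hconn : ∀ c, ∃ q, (q, c) ∈ O := by
    intro c
    have hr : Relation.ReflTransGen G.Adj d.2 c :=
      (reachable_iff_reflTransGen _ _).1 (hG.connected.preconnected _ _)
    induction hr with
    | refl => exact ⟨d.1, 0, rfl⟩
    | @tail u v _ huv ih =>
      obtain ⟨q, hq⟩ := ih
      exact ⟨u, hOrev _ _ (hall u q v hq huv.symm)⟩
  obtain ⟨q, i, hi⟩ := hconn b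
  obtain ⟨p, hp, hpc, hpe⟩ := hper ⟨d, hd⟩
  refine ⟨i % p, (Nat.mod_lt _ hp).trans_le (hpc.trans hcard), ?_⟩
  have : f^[i % p] ⟨d, hd⟩ = f^[i] ⟨d, hd⟩ := Function.IsPeriodicPt.iterate_mod_apply hpe i
  have := congrArg Subtype.val this
  rw [hfi, hfi] at this
  rw [this, hi]

end SimpleGraph

namespace TreeNaming

open SimpleGraph RobotAlgorithm

/-! ### The traversal, and the robots that share an identifier -/

/-- What a robot is doing: it follows the Euler tour (`tour`), it follows the arrows towards another
robot (`seek`), it returns to the place where it started to follow arrows (`back`), or it has just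
changed its identifier (`fresh`). -/
inductive Mode
  | tour
  | seek
  | back
  | fresh
  deriving DecidableEq

instance : Fintype Mode :=
  ⟨{.tour, .seek, .back, .fresh}, fun m => by cases m <;> simp⟩

theorem card_mode : Fintype.card Mode = 4 := rfl

/-- What the whiteboard of a node keeps for one identifier: the port `last` by which a robot with
this identifier left the node most recently (the arrow of the node), the port `ret` by which a robot
entered it when it was following arrows, and whether that robot started to follow arrows there. -/
structure Entry (P : Type*) where
  last : P
  ret : P
  start : Bool

open Classical in
/-- The traversal. A robot in mode `m` that entered a node by the port `q` and finds the entry `E`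
there leaves the node with the entry `(rule nxt q m E).1`, by the port `last` of this new entry, in
mode `(rule nxt q m E).2`.

If it has not come back by the port through which its identifier left, the robot follows the arrow.
Otherwise, it continues the Euler tour; or it has followed the arrows to their end and turns back;
or it is on its way back, continuing the tour where it was interrupted once it has arrived there. -/
noncomputable def rule {P : Type*} (nxt : P → P) (q : Option P) (m : Mode) (E : Entry P) :
    Entry P × Mode :=
  if m = .fresh ∨ q ≠ some E.last then (⟨E.last, q.getD E.last, decide (m ≠ .seek)⟩, .seek)
  else match m with
    | .tour => (⟨nxt E.last, E.ret, E.start⟩, .tour)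
    | .back =>
      -- The second alternative never occurs in a proper return. It keeps a robot that follows
      -- corrupted `ret` ports from bouncing on an edge forever.
      if E.start = true ∨ E.ret = E.last then (⟨nxt E.ret, E.ret, E.start⟩, .tour)
      else (⟨E.ret, E.ret, E.start⟩, .back)
    | _ => (E, .back)

section rule

variable {P : Type*} {nxt : P → P} {q : Option P} {m : Mode} {E : Entry P}

theorem rule_of_unexpected (h : m = .fresh ∨ q ≠ some E.last) :
    rule nxt q m E = (⟨E.last, q.getD E.last, decide (m ≠ .seek)⟩, .seek) := if_pos h

theorem rule_tour (h : q = some E.last) :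
    rule nxt q .tour E = (⟨nxt E.last, E.ret, E.start⟩, .tour) := by
  simp [rule, h]

theorem rule_seek (h : q = some E.last) : rule nxt q .seek E = (E, .back) := by
  simp [rule, h]

theorem rule_back (h : q = some E.last) (h' : ¬ (E.start = true ∨ E.ret = E.last)) :
    rule nxt q .back E = (⟨E.ret, E.ret, E.start⟩, .back) := by
  rw [rule, if_neg (by simp [h])]; exact if_neg h'

theorem rule_back_of_start (h : q = some E.last) (h' : E.start = true ∨ E.ret = E.last) :
    rule nxt q .back E = (⟨nxt E.ret, E.ret, E.start⟩, .tour) := by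
  rw [rule, if_neg (by simp [h])]; exact if_pos h'

/-- The port by which the robot leaves is an old one, or the one that follows an old one. -/
theorem rule_last_mem (S : P → Prop) (hl : S E.last) (hr : S E.ret) (hn : ∀ p, S p → S (nxt p)) :
    S (rule nxt q m E).1.last := by
  by_cases h : m = .fresh ∨ q ≠ some E.last
  · rwa [rule_of_unexpected h]
  · push Not at h
    cases m with
    | tour => rw [rule_tour h.2]; exact hn _ hl
    | seek => rwa [rule_seek h.2]
    | back =>
      by_cases h' : E.start = true ∨ E.ret = E.last
      · rw [rule_back_of_start h.2 h']; exact hn _ hr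
      · rwa [rule_back h.2 h']
    | fresh => exact absurd rfl h.1

end rule

/-- The robots with one fixed identifier (the tokens) and their traversal, seen at the level of
nodes, during a time interval `[0, T]` in which no robot gives up this identifier and no two of them
are on the same node. Robots may adopt the identifier. -/
structure TokenRun {V : Type*} (G : SimpleGraph V) (nxt : V → V → V) (ι : Type*) (T : ℕ) where
  tok : ℕ → ι → Prop
  pos : ℕ → ι → V
  src : ℕ → ι → Option V
  mode : ℕ → ι → Mode
  ent : ℕ → V → Entry V
  last_adj : ∀ t u, G.Adj u (ent t u).last
  ret_adj : ∀ t u, G.Adj u (ent t u).ret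
  src_adj : ∀ t r w, src t r = some w → G.Adj (pos t r) w
  tok_succ : ∀ t < T, ∀ r, tok t r → tok (t + 1) r
  /-- A token stays or moves. -/
  step : ∀ t < T, ∀ r, tok t r →
    (pos (t + 1) r = pos t r ∧ src (t + 1) r = src t r ∧ mode (t + 1) r = mode t r ∧
      ent (t + 1) (pos t r) = ent t (pos t r)) ∨
    (pos (t + 1) r = (rule (nxt (pos t r)) (src t r) (mode t r) (ent t (pos t r))).1.last ∧
      src (t + 1) r = some (pos t r) ∧
      mode (t + 1) r = (rule (nxt (pos t r)) (src t r) (mode t r) (ent t (pos t r))).2 ∧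
      ent (t + 1) (pos t r) = (rule (nxt (pos t r)) (src t r) (mode t r) (ent t (pos t r))).1)
  mode_of_join : ∀ t < T, ∀ r, ¬ tok t r → tok (t + 1) r → mode (t + 1) r = .fresh
  ent_succ : ∀ t < T, ∀ u, (∀ r, tok t r → pos t r ≠ u) → ent (t + 1) u = ent t u
  no_swap : ∀ t < T, ∀ r r', tok t r → tok t r' → pos (t + 1) r = pos t r' →
    pos (t + 1) r' = pos t r → pos t r = pos t r'
  no_meet : ∀ t ≤ T, ∀ r r', tok t r → tok t r' → pos t r = pos t r' → r = r'

namespace TokenRun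

variable {V : Type*} {G : SimpleGraph V} {nxt : V → V → V} {ι : Type*} {T : ℕ}
  (R : TokenRun G nxt ι T)

/-- The node to which the token `r` goes next. -/
noncomputable def tgt (t : ℕ) (r : ι) : V :=
  (rule (nxt (R.pos t r)) (R.src t r) (R.mode t r) (R.ent t (R.pos t r))).1.last

/-- The node to which the arrow of `u` points. -/
def arrow (t : ℕ) (u : V) : V := (R.ent t u).last

/-- The token `r` has not come back by the edge through which a token left its node most recently.
-/
def Unexpected (t : ℕ) (r : ι) : Prop := R.src t r ≠ some (R.arrow t (R.pos t r))

/-- A path of arrows that begins with the edge from `x` to `y` ends in a token. -/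
inductive Lead (t : ℕ) : V → V → Prop
  | tok {x y : V} (r : ι) : R.tok t r → R.pos t r = y → Lead t x y
  | next {x y : V} : (∀ r, R.tok t r → R.pos t r ≠ y) → R.arrow t y ≠ x →
      Lead t y (R.arrow t y) → Lead t x y

/-- The token `r` chases another token. -/
def Chase (t : ℕ) (r : ι) : Prop := R.tok t r ∧ R.Lead t (R.pos t r) (R.tgt t r)

/-- The same tokens during a shorter time. -/
def restrict {T' : ℕ} (h : T' ≤ T) : TokenRun G nxt ι T' :=
  { R with
    tok_succ := fun t ht => R.tok_succ t (ht.trans_le h)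
    step := fun t ht => R.step t (ht.trans_le h)
    mode_of_join := fun t ht => R.mode_of_join t (ht.trans_le h)
    ent_succ := fun t ht => R.ent_succ t (ht.trans_le h)
    no_swap := fun t ht => R.no_swap t (ht.trans_le h)
    no_meet := fun t ht => R.no_meet t (ht.trans h) }

variable {R}

theorem tgt_eq_arrow {t : ℕ} {r : ι} (h : R.mode t r = .fresh ∨ R.Unexpected t r) :
    R.tgt t r = R.arrow t (R.pos t r) := by
  unfold tgt
  rw [rule_of_unexpected h]; rfl

theorem tok_of_le {t t' : ℕ} {r : ι} (h : R.tok t r) (htt : t ≤ t') (ht' : t' ≤ T) :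
    R.tok t' r := by
  induction t', htt using Nat.le_induction with
  | base => exact h
  | succ s _ ih => exact R.tok_succ s (by omega) r (ih (by omega))

theorem arrow_adj (t : ℕ) (u : V) : G.Adj u (R.arrow t u) := R.last_adj t u

theorem tgt_adj (hn : G.IsRotation nxt) (t : ℕ) (r : ι) : G.Adj (R.pos t r) (R.tgt t r) :=
  rule_last_mem (G.Adj (R.pos t r)) (R.last_adj _ _) (R.ret_adj _ _) fun _ => hn.adj

theorem tgt_of_stay {t : ℕ} {r : ι} (h1 : R.pos (t + 1) r = R.pos t r)
    (h2 : R.src (t + 1) r = R.src t r) (h3 : R.mode (t + 1) r = R.mode t r)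
    (h4 : R.ent (t + 1) (R.pos t r) = R.ent t (R.pos t r)) : R.tgt (t + 1) r = R.tgt t r := by
  unfold tgt; rw [h1, h2, h3, h4]

/-- The only way to break a path of arrows that leads to a token is that a token comes back along
its first edge. -/
theorem lead_succ {t : ℕ} (ht : t < T) {x y : V} (h : R.Lead t x y) :
    R.Lead (t + 1) x y ∨ ∃ r, R.tok t r ∧ R.pos t r = y ∧ R.pos (t + 1) r = x := by
  induction h with
  | @tok x y r hr hy =>
    subst hy
    rcases R.step t ht r hr with ⟨h1, -⟩ | ⟨h1, -, -, h4⟩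
    · exact .inl (.tok r (R.tok_succ t ht r hr) h1)
    · by_cases hx : R.pos (t + 1) r = x
      · exact .inr ⟨r, hr, rfl, hx⟩
      · left
        by_cases hc : ∃ s, R.tok (t + 1) s ∧ R.pos (t + 1) s = R.pos t r
        · obtain ⟨s, hs, hs'⟩ := hc
          exact .tok s hs hs'
        · push Not at hc
          have : R.arrow (t + 1) (R.pos t r) = R.pos (t + 1) r := by
            rw [arrow, h4, h1]
          exact .next hc (this ▸ hx) (.tok r (R.tok_succ t ht r hr) this.symm)
  | @next x y hno hne _ ih =>
    left
    by_cases hc : ∃ s, R.tok (t + 1) s ∧ R.pos (t + 1) s = y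
    · obtain ⟨s, hs, hs'⟩ := hc
      exact .tok s hs hs'
    · push Not at hc
      have he : R.arrow (t + 1) y = R.arrow t y := by rw [arrow, R.ent_succ t ht y hno]; rfl
      refine .next hc (he ▸ hne) ?_
      rw [he]
      rcases ih with ih | ⟨r, hr, -, hr'⟩
      · exact ih
      · exact absurd hr' (hc r (R.tok_succ t ht r hr))

/-- A chase goes on, and the token that chases never turns back. -/
theorem chase_succ (hn : G.IsRotation nxt) {t : ℕ} (ht : t < T) {r : ι} (h : R.Chase t r) :
    R.Chase (t + 1) r ∧
      (R.pos (t + 1) r = R.pos t r ∧ R.tgt (t + 1) r = R.tgt t r ∨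
        R.pos (t + 1) r = R.tgt t r ∧ R.tgt (t + 1) r ≠ R.pos t r) := by
  obtain ⟨hr, hl⟩ := h
  have hr1 := R.tok_succ t ht r hr
  have hadj := R.tgt_adj hn t r
  rcases R.step t ht r hr with ⟨h1, h2, h3, h4⟩ | ⟨h1, h2, -, -⟩
  · have htgt := tgt_of_stay h1 h2 h3 h4
    refine ⟨⟨hr1, ?_⟩, .inl ⟨h1, htgt⟩⟩
    rw [h1, htgt]
    rcases lead_succ ht hl with hl | ⟨s, hs, hs1, hs2⟩
    · exact hl
    · have := R.no_meet (t + 1) ht s r (R.tok_succ t ht s hs) hr1 (hs2.trans h1.symm)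
      subst this
      exact absurd hs1 hadj.ne
  · replace h1 : R.pos (t + 1) r = R.tgt t r := h1
    -- on the new node, the arrow does not point back
    suffices h : R.arrow (t + 1) (R.tgt t r) ≠ R.pos t r ∧
        R.Lead (t + 1) (R.tgt t r) (R.arrow (t + 1) (R.tgt t r)) by
      have htgt : R.tgt (t + 1) r = R.arrow (t + 1) (R.tgt t r) := by
        rw [tgt_eq_arrow, h1]
        right
        rw [Unexpected, h2, h1]
        exact fun he => h.1 (Option.some.inj he).symm
      exact ⟨⟨hr1, by rw [htgt, h1]; exact h.2⟩, .inr ⟨h1, htgt ▸ h.1⟩⟩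
    generalize R.tgt t r = y at *
    cases hl with
    | tok s hs hs' =>
      subst hs'
      have hsr : s ≠ r := fun he => hadj.ne (by rw [he])
      rcases R.step t ht s hs with ⟨k1, -⟩ | ⟨k1, -, -, k4⟩
      · exact absurd (R.no_meet (t + 1) ht s r (R.tok_succ t ht s hs) hr1 (k1.trans h1.symm)) hsr
      · have ha : R.arrow (t + 1) (R.pos t s) = R.pos (t + 1) s := by rw [arrow, k4, k1]
        rw [ha]
        refine ⟨fun he => ?_, .tok s (R.tok_succ t ht s hs) rfl⟩
        exact hadj.ne (R.no_swap t ht r s hr hs h1 he)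
    | next hno hne hl =>
      have he : R.arrow (t + 1) y = R.arrow t y := by rw [arrow, R.ent_succ t ht y hno]; rfl
      rw [he]
      refine ⟨hne, ?_⟩
      rcases lead_succ ht hl with hl | ⟨s, hs, hs1, hs2⟩
      · exact hl
      · have := R.no_meet (t + 1) ht s r (R.tok_succ t ht s hs) hr1 (hs2.trans h1.symm)
        subst this
        exact absurd hs1.symm hne

/-- Counting the moves of a token `A` over rounds: if a property of the number of moves is kept by
the steps, then after `i` rounds it holds for a number that has grown by at least `i`. -/
theorem exists_count {f : ℕ → V} {P : ℕ → ℕ → Prop} {T' : ℕ}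
    (hP : ∀ m t, t < T' → P m t →
      (f (t + 1) = f t → P m (t + 1)) ∧ (f (t + 1) ≠ f t → P (m + 1) (t + 1)))
    {τ : ℕ → ℕ} (hτ : Monotone τ) {j i : ℕ} (hT : τ (j + i) ≤ T')
    (hmove : ∀ l, l < j + i → ∃ t, τ l ≤ t ∧ t < τ (l + 1) ∧ f (t + 1) ≠ f t)
    {m t₀ : ℕ} (ht₀ : t₀ ≤ τ j) (h0 : P m t₀) : ∃ m' ≥ m + i, P m' (τ (j + i)) := by
  have key : ∀ a b, a ≤ b → b ≤ T' → ∀ m, P m a → ∃ m' ≥ m, P m' b := by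
    intro a b hab
    induction b, hab using Nat.le_induction with
    | base => exact fun _ m hm => ⟨m, le_rfl, hm⟩
    | succ b _ ih =>
      intro hb m hm
      obtain ⟨m', hm', hp⟩ := ih (by omega) m hm
      by_cases hf : f (b + 1) = f b
      · exact ⟨m', hm', (hP m' b (by omega) hp).1 hf⟩
      · exact ⟨m' + 1, by omega, (hP m' b (by omega) hp).2 hf⟩
  induction i with
  | zero => exact key _ _ ht₀ hT m h0
  | succ i ih =>
    have hle : τ (j + i) ≤ τ (j + i + 1) := hτ (Nat.le_succ _)
    obtain ⟨m1, hm1, hp1⟩ := ih (hle.trans hT) fun l hl => hmove l (by omega)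
    obtain ⟨t, h1, h2, h3⟩ := hmove (j + i) (by omega)
    rw [← add_assoc] at hT ⊢
    obtain ⟨m2, hm2, hp2⟩ := key _ t h1 (by omega) m1 hp1
    obtain ⟨m3, hm3, hp3⟩ := key (t + 1) _ h2 hT _ ((hP m2 t (by omega) hp2).2 h3)
    exact ⟨m3, by omega, hp3⟩

variable [Fintype V]

/-- A chase cannot last more than `n` rounds: each move shrinks the part of the tree ahead. -/
theorem not_chase (hG : G.IsTree) (hn : G.IsRotation nxt) {τ : ℕ → ℕ} (hτ : Monotone τ)
    {j : ℕ} {r : ι} (hT : τ (j + Fintype.card V) ≤ T)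
    (hmove : ∀ l, l < j + Fintype.card V → R.tok (τ l) r →
      ∃ t, τ l ≤ t ∧ t < τ (l + 1) ∧ R.pos (t + 1) r ≠ R.pos t r)
    {t : ℕ} (ht : t ≤ τ j) : ¬ R.Chase t r := by
  intro h
  set n := Fintype.card V
  -- the chase goes on until the end of round `j`
  have hj : R.Chase (τ j) r := by
    have : ∀ s, t ≤ s → s ≤ T → R.Chase s r := by
      intro s hs
      induction s, hs using Nat.le_induction with
      | base => exact fun _ => h
      | succ s _ ih => exact fun hs => (chase_succ hn (by omega) (ih (by omega))).1
    exact this _ ht ((hτ (by omega)).trans hT)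
  let μ : ℕ → ℕ := fun s => (G.side (R.pos s r) (R.tgt s r)).ncard
  have hμ0 : ∀ s, 0 < μ s := fun s => (Set.ncard_pos (Set.toFinite _)).2 ⟨_, mem_side_self⟩
  have hμn : ∀ s, μ s ≤ n := fun s => by
    simpa [Set.ncard_univ] using
      Set.ncard_le_ncard (Set.subset_univ (G.side (R.pos s r) (R.tgt s r)))
  have hstep : ∀ m s, s < T → (R.Chase s r ∧ μ s + m ≤ n) →
      (R.pos (s + 1) r = R.pos s r → (R.Chase (s + 1) r ∧ μ (s + 1) + m ≤ n)) ∧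
      (R.pos (s + 1) r ≠ R.pos s r → (R.Chase (s + 1) r ∧ μ (s + 1) + (m + 1) ≤ n)) := by
    rintro m s hs ⟨hc, hle⟩
    obtain ⟨hc1, ⟨h1, h2⟩ | ⟨h1, h2⟩⟩ := chase_succ hn hs hc
    · refine ⟨fun _ => ⟨hc1, ?_⟩, fun h => absurd h1 h⟩
      simpa only [μ, h1, h2] using hle
    · refine ⟨fun h => absurd (h1.symm.trans h) (R.tgt_adj hn s r).ne', fun _ => ⟨hc1, ?_⟩⟩
      have : μ (s + 1) < μ s := by
        refine Set.ncard_lt_ncard ?_ (Set.toFinite _)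
        rw [h1]
        refine hG.isAcyclic.side_ssubset (R.tgt_adj hn s r) ?_ h2
        rw [← h1]
        exact R.tgt_adj hn _ _
      omega
  obtain ⟨m, hm, hm'⟩ := exists_count (f := fun s => R.pos s r) hstep (τ := fun l => τ (j + l))
    (j := 0) (i := n) (m := 0) (t₀ := τ j) (fun a b hab => hτ (by omega)) (by simpa using hT)
    (fun l hl => hmove _ (by omega)
      (tok_of_le hj.1 (hτ (by omega)) ((hτ (by omega)).trans hT))) le_rfl ⟨hj, hμn _⟩
  have := hμ0 (τ (j + (0 + n)))
  have := hm'.2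
  omega

end TokenRun

/-! ### Territories, and recovery from corrupted robot states -/

namespace TokenRun

variable {V : Type*} {G : SimpleGraph V} {nxt : V → V → V} {ι : Type*} {T : ℕ}
  {R : TokenRun G nxt ι T}

variable (R) in
/-- The nodes that the token `A` has visited between the times `t₁` and `t`. -/
def visited (A : ι) (t₁ t : ℕ) : Set V := {x | ∃ s, t₁ ≤ s ∧ s ≤ t ∧ R.pos s A = x}

theorem visited_self (A : ι) (t : ℕ) : R.visited A t t = {R.pos t A} := by
  ext x
  constructor
  · rintro ⟨s, h1, h2, rfl⟩
    obtain rfl := le_antisymm h1 h2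
    rfl
  · rintro rfl
    exact ⟨t, le_rfl, le_rfl, rfl⟩

theorem pos_mem_visited {A : ι} {t₁ t : ℕ} (h : t₁ ≤ t) : R.pos t A ∈ R.visited A t₁ t :=
  ⟨t, h, le_rfl, rfl⟩

theorem visited_succ {A : ι} {t₁ t : ℕ} (h : t₁ ≤ t) :
    R.visited A t₁ (t + 1) = insert (R.pos (t + 1) A) (R.visited A t₁ t) := by
  ext x
  constructor
  · rintro ⟨s, h1, h2, rfl⟩
    rcases Nat.lt_or_ge t s with h3 | h3
    · obtain rfl : s = t + 1 := by omega
      exact .inl rfl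
    · exact .inr ⟨s, h1, h3, rfl⟩
  · rintro (rfl | ⟨s, h1, h2, rfl⟩)
    · exact ⟨t + 1, by omega, le_rfl, rfl⟩
    · exact ⟨s, h1, by omega, rfl⟩

/-- As long as nobody chases, the nodes visited by `A` belong to `A`: their arrows lead to a token,
and no other token is on them, since it would begin to chase when it enters. -/
structure Territory (R : TokenRun G nxt ι T) (A : ι) (t₁ t : ℕ) : Prop where
  lead : ∀ x ∈ R.visited A t₁ t, x ≠ R.pos t A →
    R.arrow t x ∈ R.visited A t₁ t ∧ R.Lead t x (R.arrow t x)
  alone : ∀ r, R.tok t r → r ≠ A → R.pos t r ∉ R.visited A t₁ t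

theorem territory_succ {A : ι} {t₁ t : ℕ} (h1 : t₁ ≤ t) (ht : t < T) (hA : R.tok t A)
    (hc : ∀ r, ¬ R.Chase (t + 1) r) (h : R.Territory A t₁ t) : R.Territory A t₁ (t + 1) := by
  have hA1 := R.tok_succ t ht A hA
  -- the arrows of the nodes left behind lead to `A` or to somebody who has just entered
  have key : ∀ x ∈ R.visited A t₁ t, x ≠ R.pos (t + 1) A →
      R.arrow (t + 1) x ∈ R.visited A t₁ (t + 1) ∧ (R.Lead (t + 1) x (R.arrow (t + 1) x) ∨
        ∃ r, R.tok t r ∧ R.pos t r = R.arrow (t + 1) x ∧ R.pos (t + 1) r = x) := by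
    intro x hx hxA
    by_cases hxt : x = R.pos t A
    · subst hxt
      rcases R.step t ht A hA with ⟨k1, -⟩ | ⟨k1, -, -, k4⟩
      · exact absurd k1.symm hxA
      · have ha : R.arrow (t + 1) (R.pos t A) = R.pos (t + 1) A := by rw [arrow, k4, k1]
        rw [ha]
        exact ⟨pos_mem_visited (by omega), .inl (.tok A hA1 rfl)⟩
    · have hno : ∀ r, R.tok t r → R.pos t r ≠ x := by
        rintro r hr rfl
        by_cases hrA : r = A
        · exact hxt (by rw [hrA])
        · exact h.alone r hr hrA hx
      have he : R.arrow (t + 1) x = R.arrow t x := by rw [arrow, R.ent_succ t ht x hno]; rfl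
      obtain ⟨h2, h3⟩ := h.lead x hx hxt
      rw [he, visited_succ h1]
      exact ⟨.inr h2, lead_succ ht h3⟩
  have halone : ∀ r, R.tok (t + 1) r → r ≠ A → R.pos (t + 1) r ∉ R.visited A t₁ (t + 1) := by
    intro r hr hrA hmem
    have hne : R.pos (t + 1) r ≠ R.pos (t + 1) A := fun he =>
      hrA (R.no_meet (t + 1) ht r A hr hA1 he)
    rw [visited_succ h1] at hmem
    replace hmem := hmem.resolve_left hne
    obtain ⟨-, hl⟩ := key _ hmem hne
    by_cases hrt : R.tok t r
    · have hnot := h.alone r hrt hrA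
      rcases R.step t ht r hrt with ⟨k1, -⟩ | ⟨k1, k2, -, -⟩
      · exact hnot (k1 ▸ hmem)
      · -- `r` has entered the territory from outside, hence not by the arrow
        have hun : R.arrow (t + 1) (R.pos (t + 1) r) ≠ R.pos t r := by
          intro he
          by_cases hx : R.pos (t + 1) r = R.pos t A
          · rcases R.step t ht A hA with ⟨j1, -⟩ | ⟨j1, -, -, j4⟩
            · exact hne (hx.trans j1.symm)
            · have ha : R.arrow (t + 1) (R.pos t A) = R.pos (t + 1) A := by rw [arrow, j4, j1]
              have := R.no_swap t ht r A hrt hA hx (by rw [← ha, ← hx, he])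
              exact hrA (R.no_meet t ht.le r A hrt hA this)
          · have hno : ∀ s, R.tok t s → R.pos t s ≠ R.pos (t + 1) r := by
              intro s hs hse
              by_cases hsA : s = A
              · exact hx (by rw [← hse, hsA])
              · exact h.alone s hs hsA (hse ▸ hmem)
            have h2 := (h.lead _ hmem hx).1
            rw [arrow, ← R.ent_succ t ht _ hno] at h2
            exact hnot (he ▸ h2)
        have htgt : R.tgt (t + 1) r = R.arrow (t + 1) (R.pos (t + 1) r) :=
          tgt_eq_arrow (.inr (by rw [Unexpected, k2]; exact fun h => hun (Option.some.inj h).symm))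
        rcases hl with hl | ⟨s, hs, hs1, hs2⟩
        · exact hc r ⟨hr, htgt ▸ hl⟩
        · have := R.no_meet (t + 1) ht s r (R.tok_succ t ht s hs) hr hs2
          subst this
          exact hun hs1.symm
    · have htgt : R.tgt (t + 1) r = R.arrow (t + 1) (R.pos (t + 1) r) :=
        tgt_eq_arrow (.inl (R.mode_of_join t ht r hrt hr))
      rcases hl with hl | ⟨s, hs, hs1, hs2⟩
      · exact hc r ⟨hr, htgt ▸ hl⟩
      · have := R.no_meet (t + 1) ht s r (R.tok_succ t ht s hs) hr hs2
        subst this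
        exact hrt hs
  refine ⟨fun x hx hxA => ?_, halone⟩
  have hx' : x ∈ R.visited A t₁ t := by
    rw [visited_succ h1] at hx
    exact hx.resolve_left hxA
  obtain ⟨h2, h3⟩ := key x hx' hxA
  refine ⟨h2, h3.resolve_right ?_⟩
  rintro ⟨r, hr, -, rfl⟩
  exact halone r (R.tok_succ t ht r hr) (fun he => hxA (by rw [he])) hx

theorem territory {A : ι} {t₁ : ℕ} (h1 : t₁ ≤ T) (hA : R.tok t₁ A)
    (hc : ∀ t ≤ T, ∀ r, ¬ R.Chase t r) {t : ℕ} (h : t₁ ≤ t) (ht : t ≤ T) :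
    R.Territory A t₁ t := by
  induction t, h using Nat.le_induction with
  | base =>
    refine ⟨fun x hx hxA => ?_, fun r hr hrA hmem => ?_⟩
    · rw [visited_self] at hx
      exact absurd hx hxA
    · rw [visited_self] at hmem
      exact hrA (R.no_meet t₁ h1 r A hr hA hmem)
  | succ t h ih =>
    exact territory_succ h (by omega) (tok_of_le hA h (by omega)) (hc _ ht) (ih (by omega))

/-- The state of a token whose future does not depend on corrupted data of the whiteboards. -/
def Proper (R : TokenRun G nxt ι T) (t : ℕ) (A : ι) : Prop :=
  R.mode t A = .tour ∨ R.mode t A = .fresh ∨ (R.mode t A = .back ∧ R.Unexpected t A)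

/-- A token becomes proper within `2n + 2` moves, for it moves without turning back, but once, until
then. -/
theorem exists_proper [Fintype V] (hG : G.IsTree) (hn : G.IsRotation nxt) {A : ι} {τ : ℕ → ℕ}
    (hτ : Monotone τ) (hA : R.tok (τ 0) A) (hT : τ (2 * Fintype.card V + 2) ≤ T)
    (hmove : ∀ l, l < 2 * Fintype.card V + 2 →
      ∃ t, τ l ≤ t ∧ t < τ (l + 1) ∧ R.pos (t + 1) A ≠ R.pos t A) :
    ∃ t, τ 0 ≤ t ∧ t ≤ τ (2 * Fintype.card V + 2) ∧ R.Proper t A := by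
  classical
  by_contra hno
  push Not at hno
  set n := Fintype.card V
  set T' := τ (2 * n + 2)
  let σ : ℕ → ℕ := fun t => (G.side (R.pos t A) (R.tgt t A)).ncard
  have hσ0 : ∀ s, 0 < σ s := fun s => (Set.ncard_pos (Set.toFinite _)).2 ⟨_, mem_side_self⟩
  have hσn : ∀ s, σ s ≤ n := fun s => by
    simpa [Set.ncard_univ] using
      Set.ncard_le_ncard (Set.subset_univ (G.side (R.pos s A) (R.tgt s A)))
  let Q : ℕ → ℕ := fun t =>
    if R.mode t A = .seek then
      if R.Unexpected t A then n + 1 + σ t else n + 1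
    else if (R.ent t (R.pos t A)).start = true ∨
        (R.ent t (R.pos t A)).ret = (R.ent t (R.pos t A)).last then 0
    else σ t
  have hσlt : ∀ t, R.pos (t + 1) A = R.tgt t A → R.tgt (t + 1) A ≠ R.pos t A → σ (t + 1) < σ t := by
    intro t h1 h2
    refine Set.ncard_lt_ncard ?_ (Set.toFinite _)
    rw [h1]
    refine hG.isAcyclic.side_ssubset (R.tgt_adj hn t A) ?_ h2
    rw [← h1]
    exact R.tgt_adj hn _ _
  have hstep : ∀ m t, t < T' → (τ 0 ≤ t ∧ R.tok t A ∧ Q t + m ≤ 2 * n + 1) →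
      (R.pos (t + 1) A = R.pos t A → (τ 0 ≤ t + 1 ∧ R.tok (t + 1) A ∧ Q (t + 1) + m ≤ 2 * n + 1)) ∧
      (R.pos (t + 1) A ≠ R.pos t A →
        (τ 0 ≤ t + 1 ∧ R.tok (t + 1) A ∧ Q (t + 1) + (m + 1) ≤ 2 * n + 1)) := by
    rintro m t ht ⟨h0, hA, hle⟩
    have hA1 := R.tok_succ t (by omega) A hA
    have hp := hno t h0 ht.le
    have hp1 := hno (t + 1) (by omega) ht
    rcases R.step t (by omega) A hA with ⟨h1, h2, h3, h4⟩ | ⟨h1, h2, h3, h4⟩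
    · refine ⟨fun _ => ⟨by omega, hA1, ?_⟩, fun h => absurd h1 h⟩
      have : Q (t + 1) = Q t := by
        have hu : R.Unexpected (t + 1) A ↔ R.Unexpected t A := by
          simp only [Unexpected, arrow, h1, h2, h4]
        have hσ : σ (t + 1) = σ t := by simp only [σ, tgt_of_stay h1 h2 h3 h4, h1]
        simp only [Q, hu, hσ, h1, h3, h4]
      omega
    · have hpos : R.pos (t + 1) A = R.tgt t A := h1
      refine ⟨fun h => absurd (h1.symm.trans h) (R.tgt_adj hn t A).ne',
        fun _ => ⟨by omega, hA1, ?_⟩⟩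
      suffices Q (t + 1) < Q t by omega
      simp only [Proper, not_or, not_and] at hp hp1
      rcases hm : R.mode t A with _ | _ | _ | _
      · exact absurd hm hp.1
      · by_cases hu : R.Unexpected t A
        · have hQ : Q t = n + 1 + σ t := by simp [Q, hm, hu]
          rw [rule_of_unexpected (.inr hu)] at h3
          rw [hQ]
          simp only [Q, h3, if_true]
          split_ifs with hu'
          · have := hσlt t hpos (by
              rw [tgt_eq_arrow (.inr hu')]
              exact fun he => hu' (h2.trans (congrArg some he.symm)))
            omega
          · have := hσ0 t
            omega
        · have hQ : Q t = n + 1 := by simp [Q, hm, hu]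
          rw [hm, rule_seek (not_not.1 hu)] at h3
          rw [hQ]
          have := hσn (t + 1)
          simp only [Q, h3, reduceCtorEq, if_false]
          split_ifs <;> omega
      · have hu : R.src t A = some (R.ent t (R.pos t A)).last := not_not.1 (hp.2.2 hm)
        by_cases hs : (R.ent t (R.pos t A)).start = true ∨
            (R.ent t (R.pos t A)).ret = (R.ent t (R.pos t A)).last
        · rw [hm, rule_back_of_start hu hs] at h3
          exact absurd h3 hp1.1
        · have hQ : Q t = σ t := by simp only [Q, hm, reduceCtorEq, if_false, if_neg hs]
          rw [hm, rule_back hu hs] at h3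
          have hu1 : R.src (t + 1) A = some (R.ent (t + 1) (R.pos (t + 1) A)).last :=
            not_not.1 (hp1.2.2 h3)
          rw [hQ]
          simp only [Q, h3, reduceCtorEq, if_false]
          split_ifs with hs1
          · exact hσ0 t
          · refine hσlt t hpos ?_
            unfold tgt
            rw [h3, rule_back hu1 hs1]
            rw [h2] at hu1
            intro he
            exact hs1 (.inr (he.trans (Option.some.inj hu1)))
      · exact absurd hm hp.2.1
  have hQ0 : Q (τ 0) ≤ 2 * n + 1 := by
    have := hσn (τ 0)
    simp only [Q]
    split_ifs <;> omega
  obtain ⟨m, hm, -, -, hm'⟩ := exists_count (f := fun s => R.pos s A) hstep hτ (j := 0)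
    (i := 2 * n + 2) (m := 0) (t₀ := τ 0) (by simp [T']) (by simpa using hmove) le_rfl
    ⟨le_rfl, hA, hQ0⟩
  omega

end TokenRun

/-! ### Tours with excursions -/

/-- The nodes on which a robot has followed arrows since it interrupted its tour on the dart `d`,
the latest one first: their `ret` ports lead back to the head of `d`. -/
def Stack {V : Type*} (e : V → Entry V) : List V → V × V → Prop
  | [], _ => False
  | [v], d => d.2 = v ∧ (e v).start = true ∧ (e v).ret = d.1
  | x :: y :: L, d => (e x).start = false ∧ (e x).ret = y ∧ (e x).last ≠ y ∧ Stack e (y :: L) d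

theorem Stack.congr {V : Type*} {e e' : V → Entry V} {d : V × V} :
    ∀ {L : List V}, (∀ v ∈ L, e' v = e v) → Stack e L d → Stack e' L d
  | [], _, hs => hs
  | [v], h, hs => by simpa only [Stack, h v (by simp)] using hs
  | x :: y :: L, h, hs => by
    simp only [Stack, h x (by simp)] at hs ⊢
    exact ⟨hs.1, hs.2.1, hs.2.2.1, hs.2.2.2.congr fun v hv => h v (List.mem_cons_of_mem _ hv)⟩

namespace TokenRun

variable {V : Type*} {G : SimpleGraph V} {nxt : V → V → V} {ι : Type*} {T : ℕ}
  {R : TokenRun G nxt ι T}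

variable (R) in
/-- The arrows of the nodes that `A` has visited since `t₁` point towards `A`. -/
def Facing (A : ι) (t₁ t : ℕ) : Prop :=
  ∀ y ∈ R.visited A t₁ t, y ≠ R.pos t A → R.pos t A ∈ G.side y (R.arrow t y)

theorem ent_eq_of_mem_visited {A : ι} {t₁ t : ℕ} (ht : t < T) (hT : R.Territory A t₁ t) {y : V}
    (hy : y ∈ R.visited A t₁ t) (hne : y ≠ R.pos t A) : R.ent (t + 1) y = R.ent t y := by
  refine R.ent_succ t ht y ?_
  rintro r hr rfl
  by_cases hrA : r = A
  · exact hne (by rw [hrA])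
  · exact hT.alone r hr hrA hy

theorem facing_of_stay {A : ι} {t₁ t : ℕ} (h1 : t₁ ≤ t) (ht : t < T)
    (hT : R.Territory A t₁ t) (hf : R.Facing A t₁ t) (hp : R.pos (t + 1) A = R.pos t A) :
    R.visited A t₁ (t + 1) = R.visited A t₁ t ∧ R.Facing A t₁ (t + 1) := by
  have hv : R.visited A t₁ (t + 1) = R.visited A t₁ t := by
    rw [visited_succ h1, hp, Set.insert_eq_of_mem (pos_mem_visited h1)]
  refine ⟨hv, fun y hy hne => ?_⟩
  rw [hv] at hy
  rw [hp] at hne ⊢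
  have := hf y hy hne
  rwa [arrow, ent_eq_of_mem_visited ht hT hy hne]

theorem facing_of_move (hG : G.IsTree) {A : ι} {t₁ t : ℕ} (h1 : t₁ ≤ t) (ht : t < T)
    (hT : R.Territory A t₁ t) (hf : R.Facing A t₁ t) (hadj : G.Adj (R.pos t A) (R.pos (t + 1) A))
    (harr : R.arrow (t + 1) (R.pos t A) = R.pos (t + 1) A) : R.Facing A t₁ (t + 1) := by
  intro y hy hne
  by_cases hyt : y = R.pos t A
  · subst hyt
    rw [harr]
    exact mem_side_self
  · rw [visited_succ h1] at hy
    replace hy := hy.resolve_left hne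
    rw [arrow, ent_eq_of_mem_visited ht hT hy hyt]
    by_contra hno
    exact hne (hG.isAcyclic.eq_of_notMem_side (R.arrow_adj t y) (hf y hy hyt) hadj hno).2.symm

/-- A visited node is entered by its arrow. -/
theorem arrow_eq_of_mem_visited (hG : G.IsTree) {A : ι} {t₁ t : ℕ} (ht : t < T)
    (hT : R.Territory A t₁ t) (hf : R.Facing A t₁ t) (hadj : G.Adj (R.pos t A) (R.pos (t + 1) A))
    (hv : R.pos (t + 1) A ∈ R.visited A t₁ t) :
    R.arrow (t + 1) (R.pos (t + 1) A) = R.pos t A := by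
  rw [arrow, ent_eq_of_mem_visited ht hT hv hadj.ne']
  exact (hG.isAcyclic.eq_of_mem_side (R.arrow_adj t _) hadj.symm (hf _ hv hadj.ne')).symm

/-- On a new node, an arrow that does not point back points to another new node. -/
theorem arrow_eq_or_notMem (hG : G.IsTree) {A : ι} {t₁ t : ℕ} (h1 : t₁ ≤ t) (ht : t < T)
    (hT : R.Territory A t₁ t) (hf : R.Facing A t₁ t) (hadj : G.Adj (R.pos t A) (R.pos (t + 1) A))
    (harr : R.arrow (t + 1) (R.pos t A) = R.pos (t + 1) A) :
    R.arrow (t + 1) (R.pos (t + 1) A) = R.pos t A ∨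
      R.arrow (t + 1) (R.pos (t + 1) A) ∉ R.visited A t₁ (t + 1) := by
  by_cases hv : R.pos (t + 1) A ∈ R.visited A t₁ t
  · exact .inl (arrow_eq_of_mem_visited hG ht hT hf hadj hv)
  · by_contra! hcon
    obtain ⟨hne, hmem⟩ := hcon
    have hadj' := R.arrow_adj (t + 1) (R.pos (t + 1) A)
    generalize hw : R.arrow (t + 1) (R.pos (t + 1) A) = w at *
    have h3 : w ∈ R.visited A t₁ t := by
      rw [visited_succ h1] at hmem
      exact hmem.resolve_left hadj'.ne'
    have h4 : R.arrow (t + 1) w = R.arrow t w := by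
      rw [arrow, ent_eq_of_mem_visited ht hT h3 hne]; rfl
    have h5 := facing_of_move hG h1 ht hT hf hadj harr w hmem hadj'.ne'
    have h6 := hG.isAcyclic.eq_of_mem_side (R.arrow_adj (t + 1) w) hadj'.symm h5
    exact hv (h6 ▸ h4 ▸ (hT.lead w h3 hne).1)

/-- The state of a token `A` that was proper at time `t₁` and has moved `m` times since then. The
Euler tour that began with the dart `d` has advanced by `adv` darts, up to the dart `c`. All other
moves belong to excursions along arrows and back, each of which leads through nodes not visited
before, so that `m` is at most `adv` plus twice the number of visited nodes. -/
inductive Phase (R : TokenRun G nxt ι T) (A : ι) (t₁ m t adv : ℕ) (c : V × V) : Prop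
  | tour : R.Proper t A → c = ((R.src t A).getD (R.arrow t (R.pos t A)), R.pos t A) →
      (R.arrow t (R.pos t A) ∉ R.visited A t₁ t ∨
        (¬ R.Unexpected t A ∧ R.mode t A = .tour)) →
      m + 2 ≤ adv + 2 * (R.visited A t₁ t).ncard → Phase R A t₁ m t adv c
  | seek (y : V) (L : List V) : R.mode t A = .seek → R.src t A = some y →
      Stack (R.ent t) (y :: L) c → (y :: L).Nodup → (∀ v ∈ y :: L, v ∈ R.visited A t₁ t) →
      R.pos t A ∉ y :: L →
      (R.arrow t (R.pos t A) ∉ R.visited A t₁ t ∨ R.arrow t (R.pos t A) = y) →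
      m + L.length + 3 ≤ adv + 2 * (R.visited A t₁ t).ncard → Phase R A t₁ m t adv c
  | back (L : List V) : R.mode t A = .back → ¬ R.Unexpected t A →
      Stack (R.ent t) (R.pos t A :: L) c → (R.pos t A :: L).Nodup →
      (∀ v ∈ L, v ∈ R.visited A t₁ t) →
      m + L.length + 2 ≤ adv + 2 * (R.visited A t₁ t).ncard → Phase R A t₁ m t adv c

variable (R) in
/-- The token `A` has moved `m` times between `t₁` and `t`, and it is in a `Phase` of a tour that
began with the dart `d`, all of whose nodes have been visited. -/
def Progress (A : ι) (t₁ : ℕ) (d : V × V) (m t : ℕ) : Prop :=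
  t₁ ≤ t ∧ R.tok t A ∧ R.Facing A t₁ t ∧ ∃ adv,
    (∀ i ≤ adv, ((turn nxt)^[i] d).2 ∈ R.visited A t₁ t) ∧
      R.Phase A t₁ m t adv ((turn nxt)^[adv] d)

theorem progress_of_stay {A : ι} {t₁ t m : ℕ} {d : V × V} (ht : t < T)
    (hT : R.Territory A t₁ t) (h : R.Progress A t₁ d m t)
    (k1 : R.pos (t + 1) A = R.pos t A) (k2 : R.src (t + 1) A = R.src t A)
    (k3 : R.mode (t + 1) A = R.mode t A) (k4 : R.ent (t + 1) (R.pos t A) = R.ent t (R.pos t A)) :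
    R.Progress A t₁ d m (t + 1) := by
  obtain ⟨h1, hA, hf, adv, hadv, hp⟩ := h
  obtain ⟨hv, hf'⟩ := facing_of_stay h1 ht hT hf k1
  have he : ∀ v ∈ R.visited A t₁ t, R.ent (t + 1) v = R.ent t v := by
    intro v hv
    by_cases hvA : v = R.pos t A
    · rw [hvA, k4]
    · exact ent_eq_of_mem_visited ht hT hv hvA
  have ha : R.arrow (t + 1) (R.pos (t + 1) A) = R.arrow t (R.pos t A) := by
    rw [k1, arrow, k4]; rfl
  have hu : R.Unexpected (t + 1) A ↔ R.Unexpected t A := by rw [Unexpected, Unexpected, ha, k2]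
  refine ⟨by omega, R.tok_succ t ht A hA, hf', adv, by rwa [hv], ?_⟩
  cases hp with
  | tour p1 p2 p3 p4 =>
    refine .tour ?_ ?_ ?_ ?_
    · simpa only [Proper, k3, hu] using p1
    · rw [k2, ha, k1, p2]
    · rwa [ha, hv, hu, k3]
    · rwa [hv]
  | seek y L p1 p2 p3 p4 p5 p6 p7 p8 =>
    refine .seek y L (k3.trans p1) (k2.trans p2) (p3.congr fun v hv => he v (p5 v hv)) p4
      ?_ ?_ ?_ ?_
    · rwa [hv]
    · rwa [k1]
    · rwa [ha, hv]
    · rwa [hv]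
  | back L p1 p2 p3 p4 p5 p6 =>
    refine .back L (k3.trans p1) (hu.not.2 p2) ?_ (by rwa [k1]) (by rwa [hv]) (by rwa [hv])
    rw [k1]
    refine p3.congr fun v hv => ?_
    rcases List.mem_cons.1 hv with rfl | hv
    · exact k4
    · exact he v (p5 v hv)

theorem progress_of_move [Finite V] (hG : G.IsTree) (hn : G.IsRotation nxt) {A : ι} {t₁ t m : ℕ}
    {d : V × V} (ht : t < T) (hT : R.Territory A t₁ t) (h : R.Progress A t₁ d m t)
    (k1 : R.pos (t + 1) A = R.tgt t A) (k2 : R.src (t + 1) A = some (R.pos t A))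
    (k3 : R.mode (t + 1) A =
      (rule (nxt (R.pos t A)) (R.src t A) (R.mode t A) (R.ent t (R.pos t A))).2)
    (k4 : R.ent (t + 1) (R.pos t A) =
      (rule (nxt (R.pos t A)) (R.src t A) (R.mode t A) (R.ent t (R.pos t A))).1) :
    R.Progress A t₁ d (m + 1) (t + 1) := by
  obtain ⟨h1, hA, hf, adv, hadv, hp⟩ := h
  have hadj : G.Adj (R.pos t A) (R.pos (t + 1) A) := k1 ▸ R.tgt_adj hn t A
  have harr : R.arrow (t + 1) (R.pos t A) = R.pos (t + 1) A := by rw [arrow, k4, k1]; rfl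
  have hf' := facing_of_move hG h1 ht hT hf hadj harr
  have harr' := arrow_eq_or_notMem hG h1 ht hT hf hadj harr
  have hback := arrow_eq_of_mem_visited hG ht hT hf hadj
  have hvs := visited_succ (R := R) (A := A) h1
  have hx : R.pos t A ∈ R.visited A t₁ t := pos_mem_visited h1
  have hx' : R.pos (t + 1) A ∈ R.visited A t₁ (t + 1) := pos_mem_visited (by omega)
  have hsub : R.visited A t₁ t ⊆ R.visited A t₁ (t + 1) := by
    rw [hvs]; exact Set.subset_insert _ _
  have hcard : (R.visited A t₁ t).ncard ≤ (R.visited A t₁ (t + 1)).ncard :=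
    Set.ncard_le_ncard hsub (Set.toFinite _)
  have hcard' : R.pos (t + 1) A ∉ R.visited A t₁ t →
      (R.visited A t₁ (t + 1)).ncard = (R.visited A t₁ t).ncard + 1 := fun h => by
    rw [hvs, Set.ncard_insert_of_notMem h (Set.toFinite _)]
  have he : ∀ y ∈ R.visited A t₁ t, y ≠ R.pos t A → R.ent (t + 1) y = R.ent t y :=
    fun y => ent_eq_of_mem_visited ht hT
  have hadv' : ∀ i ≤ adv, ((turn nxt)^[i] d).2 ∈ R.visited A t₁ (t + 1) :=
    fun i hi => hsub (hadv i hi)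
  have hA1 := R.tok_succ t ht A hA
  -- the tour has come to the dart `c` and goes on
  have hnext : R.mode (t + 1) A = .tour →
      turn nxt ((turn nxt)^[adv] d) = (R.pos t A, R.pos (t + 1) A) →
      m + 2 ≤ adv + 2 * (R.visited A t₁ t).ncard → R.Progress A t₁ d (m + 1) (t + 1) := by
    intro hm hc hle
    refine ⟨by omega, hA1, hf', adv + 1, fun i hi => ?_, .tour (.inl hm) ?_ ?_ (by omega)⟩
    · rcases Nat.lt_or_ge adv i with h | h
      · obtain rfl : i = adv + 1 := by omega
        rw [Function.iterate_succ_apply', hc]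
        exact hx'
      · exact hadv' i h
    · rw [Function.iterate_succ_apply', hc, k2]; rfl
    · rcases harr' with h | h
      · right
        rw [Unexpected, not_not, h]
        exact ⟨k2, hm⟩
      · exact .inl h
  cases hp with
  | tour p1 p2 p3 p4 =>
    by_cases hu : R.mode t A = .fresh ∨ R.Unexpected t A
    · -- an excursion begins
      have hnew : R.pos (t + 1) A ∉ R.visited A t₁ t := by
        rw [k1, tgt_eq_arrow hu]
        refine p3.resolve_right fun h => ?_
        rcases hu with hu | hu
        · rw [h.2] at hu; cases hu
        · exact h.1 hu
      rw [rule_of_unexpected hu] at k3 k4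
      have hm : R.mode t A ≠ .seek := by
        rcases p1 with p1 | p1 | ⟨p1, -⟩ <;> simp [p1]
      refine ⟨by omega, hA1, hf', adv, hadv', .seek (R.pos t A) [] k3 k2 ?_ (by simp) ?_ ?_
        harr'.symm ?_⟩
      · refine ⟨by rw [p2], by simp [k4, hm], by rw [k4, p2]; rfl⟩
      · simpa using hsub hx
      · simpa using hadj.ne'
      · rw [hcard' hnew]; simp only [List.length_nil]; omega
    · push Not at hu
      have hm : R.mode t A = .tour := by
        rcases p1 with p1 | p1 | ⟨-, p1⟩
        · exact p1
        · exact absurd p1 hu.1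
        · exact absurd p1 hu.2
      have hs := not_not.1 hu.2
      rw [hm, rule_tour hs] at k3
      refine hnext k3 ?_ p4
      rw [p2, k1, tgt, hm, rule_tour hs, hs]; rfl
  | seek y L p1 p2 p3 p4 p5 p6 p7 p8 =>
    by_cases hu : R.Unexpected t A
    · have hay : R.arrow t (R.pos t A) ≠ y := fun h => hu (by rw [p2, h])
      have hnew : R.pos (t + 1) A ∉ R.visited A t₁ t := by
        rw [k1, tgt_eq_arrow (.inr hu)]
        exact p7.resolve_right hay
      rw [rule_of_unexpected (.inr hu)] at k3 k4
      refine ⟨by omega, hA1, hf', adv, hadv', .seek (R.pos t A) (y :: L) k3 k2 ?_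
        (List.nodup_cons.2 ⟨p6, p4⟩) ?_ ?_ harr'.symm ?_⟩
      · refine ⟨by simp [k4, p1], by rw [k4, p2]; rfl, by rw [k4]; exact hay,
          p3.congr fun v hv => ?_⟩
        exact he v (p5 v hv) (by rintro rfl; exact p6 hv)
      · intro v hv
        rcases List.mem_cons.1 hv with rfl | hv
        · exact hsub hx
        · exact hsub (p5 v hv)
      · intro hmem
        rcases List.mem_cons.1 hmem with h | h
        · exact hadj.ne' h
        · exact hnew (p5 _ h)
      · rw [hcard' hnew]; simp only [List.length_cons]; omega
    · -- the end of the arrows: the token turns back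
      have hs : R.src t A = some (R.arrow t (R.pos t A)) := not_not.1 hu
      have hy : R.arrow t (R.pos t A) = y := Option.some.inj (hs.symm.trans p2)
      have htgt : R.pos (t + 1) A = y := by
        rw [k1, tgt, p1, rule_seek hs]; exact hy
      rw [p1, rule_seek hs] at k3
      refine ⟨by omega, hA1, hf', adv, hadv', .back L k3 ?_ ?_ (htgt ▸ p4) ?_ (by omega)⟩
      · rw [Unexpected, not_not, k2, hback (htgt ▸ p5 y (by simp))]
      · rw [htgt]
        exact p3.congr fun v hv => he v (p5 v hv) (by rintro rfl; exact p6 hv)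
      · exact fun v hv => hsub (p5 v (List.mem_cons_of_mem _ hv))
  | back L p1 p2 p3 p4 p5 p6 =>
    have hs : R.src t A = some (R.arrow t (R.pos t A)) := not_not.1 p2
    cases L with
    | nil =>
      obtain ⟨q1, q2, q3⟩ := p3
      rw [p1, rule_back_of_start hs (.inl q2)] at k3
      refine hnext k3 ?_ (by simpa using p6)
      rw [k1, tgt, p1, rule_back_of_start hs (.inl q2), turn, q1, ← q3]
    | cons y L =>
      obtain ⟨q1, q2, q3, q4⟩ := p3
      have hno : ¬ ((R.ent t (R.pos t A)).start = true ∨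
          (R.ent t (R.pos t A)).ret = (R.ent t (R.pos t A)).last) := by
        rw [q1, q2]
        simpa using q3.symm
      have htgt : R.pos (t + 1) A = y := by
        rw [k1, tgt, p1, rule_back hs hno]; exact q2
      rw [p1, rule_back hs hno] at k3
      have hnot := (List.nodup_cons.1 p4).1
      simp only [List.length_cons] at p6
      refine ⟨by omega, hA1, hf', adv, hadv', .back L k3 ?_ ?_ (htgt ▸ (List.nodup_cons.1 p4).2)
        ?_ (by omega)⟩
      · rw [Unexpected, not_not, k2, hback (htgt ▸ p5 y (by simp))]
      · rw [htgt]
        exact q4.congr fun v hv => he v (p5 v hv) (by rintro rfl; exact hnot hv)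
      · exact fun v hv => hsub (p5 v (List.mem_cons_of_mem _ hv))

theorem progress_of_proper {A : ι} {t : ℕ} (hA : R.tok t A) (hp : R.Proper t A) :
    R.Progress A t ((R.src t A).getD (R.arrow t (R.pos t A)), R.pos t A) 0 t := by
  refine ⟨le_rfl, hA, fun y hy hne => ?_, 0, fun i hi => ?_, .tour hp rfl (.inl ?_) ?_⟩
  · rw [visited_self] at hy
    exact absurd hy hne
  · obtain rfl : i = 0 := by omega
    exact pos_mem_visited le_rfl
  · rw [visited_self]
    exact (R.arrow_adj t _).ne'
  · rw [visited_self]; simp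

/-- Two tokens cannot avoid each other for `7n + 2` rounds: a token becomes proper in `2n + 2`
rounds, it then needs at most `4n` moves to visit all nodes, and `n` more rounds end a chase. -/
theorem not_two_tokens [Fintype V] (R : TokenRun G nxt ι T) (hG : G.IsTree)
    (hn : G.IsRotation nxt) {τ : ℕ → ℕ} (hτ : Monotone τ) (hT : τ (7 * Fintype.card V + 2) ≤ T)
    (hmove : ∀ l, l < 7 * Fintype.card V + 2 → ∀ r, R.tok (τ l) r →
      ∃ t, τ l ≤ t ∧ t < τ (l + 1) ∧ R.pos (t + 1) r ≠ R.pos t r)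
    {A B : ι} (hA : R.tok (τ 0) A) (hB : R.tok (τ 0) B) (hAB : A ≠ B) : False := by
  set n := Fintype.card V
  -- nobody chases during the first `6n + 2` rounds
  set T' := τ (6 * n + 2)
  have hT' : T' ≤ T := (hτ (by omega)).trans hT
  have hc : ∀ t ≤ T', ∀ r, ¬ R.Chase t r := fun t ht r =>
    not_chase hG hn hτ (j := 6 * n + 2) (by convert hT using 2; omega)
      (fun l hl => hmove l (by omega) r) ht
  let R' := R.restrict hT'
  have hc' : ∀ t ≤ T', ∀ r, ¬ R'.Chase t r := by
    intro t ht r h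
    refine hc t ht r ⟨h.1, ?_⟩
    have : ∀ x y, R'.Lead t x y → R.Lead t x y := by
      intro x y hl
      induction hl with
      | tok r h1 h2 => exact .tok r h1 h2
      | next h1 h2 _ ih => exact .next h1 h2 ih
    exact this _ _ h.2
  have hmA : ∀ l, l < 6 * n + 2 → ∃ t, τ l ≤ t ∧ t < τ (l + 1) ∧ R'.pos (t + 1) A ≠ R'.pos t A :=
    fun l hl => hmove l (by omega) A (tok_of_le hA (hτ (by omega)) ((hτ (by omega)).trans hT))
  obtain ⟨t₁, h0, h1, hp⟩ := exists_proper (R := R') hG hn hτ hA (hτ (by omega))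
    fun l hl => hmA l (by omega)
  have ht₁ : t₁ ≤ T' := h1.trans (hτ (by omega))
  have hA1 : R'.tok t₁ A := tok_of_le hA h0 ht₁
  have hB1 : R'.tok t₁ B := tok_of_le hB h0 ht₁
  -- `A` never visits the node on which `B` is at time `t₁`
  have hb : ∀ t ≤ T', R'.pos t₁ B ∉ R'.visited A t₁ t := by
    rintro t ht ⟨s, hs1, hs2, hs3⟩
    have hs : s ≤ T' := hs2.trans ht
    refine (territory ht₁ hB1 hc' hs1 hs).alone A (tok_of_le hA1 hs1 hs) hAB ?_
    rw [hs3]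
    exact ⟨t₁, le_rfl, hs1, rfl⟩
  set d : V × V := ((R'.src t₁ A).getD (R'.arrow t₁ (R'.pos t₁ A)), R'.pos t₁ A) with hd
  have hdadj : G.Adj d.1 d.2 := by
    simp only [hd]
    cases hs : R'.src t₁ A with
    | none => exact (R'.arrow_adj _ _).symm
    | some w => exact (R'.src_adj _ _ _ hs).symm
  have hstep : ∀ m t, t < T' → R'.Progress A t₁ d m t →
      (R'.pos (t + 1) A = R'.pos t A → R'.Progress A t₁ d m (t + 1)) ∧
      (R'.pos (t + 1) A ≠ R'.pos t A → R'.Progress A t₁ d (m + 1) (t + 1)) := by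
    intro m t ht h
    have hterr := territory ht₁ hA1 hc' h.1 ht.le
    rcases R'.step t ht A h.2.1 with ⟨k1, k2, k3, k4⟩ | ⟨k1, k2, k3, k4⟩
    · exact ⟨fun _ => progress_of_stay ht hterr h k1 k2 k3 k4, fun h => absurd k1 h⟩
    · exact ⟨fun h => absurd (k1.symm.trans h) (R'.tgt_adj hn t A).ne',
        fun _ => progress_of_move hG hn ht hterr h k1 k2 k3 k4⟩
  obtain ⟨m, hm, -, -, -, adv, hadv, hph⟩ := exists_count (f := fun s => R'.pos s A) hstep hτ
    (j := 2 * n + 2) (i := 4 * n) (m := 0) (t₀ := t₁) (hτ (by omega))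
    (fun l hl => hmA l (by omega)) h1 (progress_of_proper hA1 hp)
  -- `adv < 2n` because the tour has not reached all nodes
  have hle : m + 2 ≤ adv + 2 * (R'.visited A t₁ (τ (2 * n + 2 + 4 * n))).ncard := by
    cases hph <;> omega
  have hvn : (R'.visited A t₁ (τ (2 * n + 2 + 4 * n))).ncard ≤ n := by
    simpa [Set.ncard_univ] using
      Set.ncard_le_ncard (Set.subset_univ (R'.visited A t₁ (τ (2 * n + 2 + 4 * n))))
  obtain ⟨i, hi, hib⟩ := hG.exists_turn_eq hn hdadj (R'.pos t₁ B)
  exact hb _ (hτ (by omega)) (hib ▸ hadv i (by omega))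

end TokenRun

/-! ### The algorithm and its steps -/

/-- The port that cyclically follows `p`. -/
def nextPort {d : ℕ} (p : Fin d) : Fin d := ⟨(p + 1) % d, Nat.mod_lt _ (by have := p.2; omega)⟩

theorem nextPort_injective {d : ℕ} : Function.Injective (nextPort (d := d)) := by
  intro p q h
  have h' : ((p : ℕ) + 1) % d = ((q : ℕ) + 1) % d := congrArg Fin.val h
  have hp := p.2
  have hq := q.2
  apply Fin.ext
  have : ∀ x : ℕ, x < d → (x + 1) % d = x + 1 ∧ x + 1 < d ∨ (x + 1) % d = 0 ∧ x + 1 = d := by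
    intro x hx
    rcases Nat.lt_or_ge (x + 1) d with h | h
    · exact .inl ⟨Nat.mod_eq_of_lt h, h⟩
    · obtain rfl : x + 1 = d := by omega
      exact .inr ⟨Nat.mod_self _, rfl⟩
  have h1 := this p hp
  have h2 := this q hq
  omega

theorem exists_iterate_nextPort {d : ℕ} (p q : Fin d) : ∃ j, nextPort^[j] p = q := by
  have key : ∀ j, ((nextPort^[j] p : Fin d) : ℕ) = (p + j) % d := by
    intro j
    induction j with
    | zero => exact (Nat.mod_eq_of_lt p.2).symm
    | succ j ih =>
      rw [Function.iterate_succ_apply', nextPort]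
      simp only [ih, Nat.mod_add_mod]
      rfl
  refine ⟨q + d - p, Fin.ext ?_⟩
  have hp := p.2
  rw [key, show (p : ℕ) + (q + d - p) = q + d by omega, Nat.add_mod_right, Nat.mod_eq_of_lt q.2]

/-- The entry that stands for an empty one. -/
def Entry.default {d : ℕ} (h : 0 < d) : Entry (Fin d) := ⟨⟨0, h⟩, ⟨0, h⟩, false⟩

/-- The image of an entry under a renaming of the ports. -/
def Entry.map {P Q : Type*} (f : P → Q) (E : Entry P) : Entry Q := ⟨f E.last, f E.ret, E.start⟩

theorem rule_map {P Q : Type*} {f : P → Q} (hf : Function.Injective f) {nxt : P → P}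
    {nxt' : Q → Q} (h : ∀ p, nxt' (f p) = f (nxt p)) (q : Option P) (m : Mode) (E : Entry P) :
    rule nxt' (q.map f) m (E.map f) = ((rule nxt q m E).1.map f, (rule nxt q m E).2) := by
  have hq : q.map f = some (E.map f).last ↔ q = some E.last := by
    rw [show some (E.map f).last = (some E.last).map f from rfl]
    exact (Option.map_injective hf).eq_iff
  by_cases hu : m = .fresh ∨ q ≠ some E.last
  · rw [rule_of_unexpected hu, rule_of_unexpected (by rwa [Ne, hq])]
    cases q <;> rfl
  · push Not at hu
    have hb : (E.map f).start = true ∨ (E.map f).ret = (E.map f).last ↔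
        E.start = true ∨ E.ret = E.last := by
      simp only [Entry.map, hf.eq_iff]
    cases m with
    | tour =>
      rw [rule_tour hu.2, rule_tour (hq.2 hu.2)]
      simp only [Entry.map, h]
    | seek => rw [rule_seek hu.2, rule_seek (hq.2 hu.2)]
    | back =>
      by_cases h' : E.start = true ∨ E.ret = E.last
      · rw [rule_back_of_start hu.2 h', rule_back_of_start (hq.2 hu.2) (hb.2 h')]
        simp only [Entry.map, h]
      · rw [rule_back hu.2 h', rule_back (hq.2 hu.2) (hb.not.2 h')]
        rfl
    | fresh => exact absurd rfl hu.1

open Classical in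
/-- The action of a robot in the naming algorithm. A robot that sees another one with its own
identifier `i` changes to the cyclically next identifier and stays; all others move according to
`rule`, each identifier using its own entry of the whiteboard. -/
noncomputable def namingCode {k : ℕ} [NeZero k] {d : ℕ} (b : Fin k → Option (Entry (Fin d)))
    (s : Fin k × Mode) (q : Option (Fin d)) (M : Multiset (Fin k × Mode)) :
    (Fin k → Option (Entry (Fin d))) × (Fin k × Mode) × Option (Fin d) :=
  if ∃ s' ∈ M, s'.1 = s.1 then (b, (s.1 + 1, .fresh), none)
  else if h : 0 < d then
    let res := rule nextPort q s.2 ((b s.1).getD (Entry.default h))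
    (Function.update b s.1 (some res.1), (s.1, res.2), some res.1.last)
  else (b, s, none)

/-- The naming algorithm. All robots of an activated node are executed. -/
noncomputable abbrev naming (k : ℕ) [NeZero k] : RobotAlgorithm k where
  State := Fin k × Mode
  Board d := Fin k → Option (Entry (Fin d))
  state_nonempty := ⟨(0, .tour)⟩
  board_nonempty _ := ⟨fun _ => none⟩
  ident s := s.1 + 1
  ident_mem s := ⟨Nat.le_add_left _ _, s.1.2⟩
  code := namingCode
  select _ := id
  select_le _ _ := le_rfl
  select_ne_zero _ _ h := h

section exec

variable {V : Type*} {k : ℕ} [NeZero k] {N : Network V}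

/-- The robot `r` shares the node `u` with another robot of the same identifier. -/
def Conflict (c : Config (naming k) N) (u : V) (l : Local (naming k) N u) (r : Fin k) : Prop :=
  ∃ x, c.pos x = u ∧ x ≠ r ∧ l.out x = none ∧ (l.state x).1 = (l.state r).1

variable {c : Config (naming k) N} {u : V} {l : Local (naming k) N u} {r x : Fin k}

theorem mem_robotsAt : x ∈ c.robotsAt u ↔ c.pos x = u := by
  simp only [Config.robotsAt, Finset.mem_filter, Finset.mem_univ, true_and]

open Classical in
theorem conflict_iff {M : Multiset (Fin k × Mode)}
    (hM : M = ((c.robotsAt u).filter fun x => x ≠ r ∧ l.out x = none).val.map l.state) :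
    (∃ s ∈ M, s.1 = (l.state r).1) ↔ Conflict c u l r := by
  subst hM
  constructor
  · rintro ⟨s, hs, h⟩
    obtain ⟨x, hx, rfl⟩ := Multiset.mem_map.1 hs
    obtain ⟨h1, h2, h3⟩ := (Finset.mem_filter (s := c.robotsAt u)).1 hx
    exact ⟨x, mem_robotsAt.1 h1, h2, h3, h⟩
  · rintro ⟨x, h1, h2, h3, h4⟩
    exact ⟨_, Multiset.mem_map_of_mem _ (Finset.mem_filter (s := c.robotsAt u).2
      ⟨mem_robotsAt.2 h1, h2, h3⟩), h4⟩

/-- The result of the action of the robot `r`. -/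
theorem exists_exec_eq (c : Config (naming k) N) (u : V) (l : Local (naming k) N u) (r : Fin k) :
    ∃ M : Multiset (Fin k × Mode), ((∃ s ∈ M, s.1 = (l.state r).1) ↔ Conflict c u l r) ∧
      c.exec u l r =
        { board := (namingCode l.board (l.state r) (N.portTo u (c.src r)) M).1
          state := Function.update l.state r
            (namingCode l.board (l.state r) (N.portTo u (c.src r)) M).2.1
          out := Function.update l.out r
            (namingCode l.board (l.state r) (N.portTo u (c.src r)) M).2.2 } :=
  ⟨_, conflict_iff (by congr!), rfl⟩

theorem exec_of_conflict (h : Conflict c u l r) : c.exec u l r =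
    { board := l.board
      state := Function.update l.state r ((l.state r).1 + 1, .fresh)
      out := Function.update l.out r none } := by
  obtain ⟨M, hM, he⟩ := exists_exec_eq c u l r
  have : namingCode l.board (l.state r) (N.portTo u (c.src r)) M =
    (l.board, ((l.state r).1 + 1, .fresh), none) := if_pos (hM.2 h)
  rw [he, this]

theorem exec_of_not_conflict (h : ¬ Conflict c u l r) (hd : 0 < N.deg u) : c.exec u l r =
    { board := Function.update l.board (l.state r).1
        (some (rule nextPort (N.portTo u (c.src r)) (l.state r).2
          ((l.board (l.state r).1).getD (Entry.default hd))).1)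
      state := Function.update l.state r ((l.state r).1,
        (rule nextPort (N.portTo u (c.src r)) (l.state r).2
          ((l.board (l.state r).1).getD (Entry.default hd))).2)
      out := Function.update l.out r
        (some (rule nextPort (N.portTo u (c.src r)) (l.state r).2
          ((l.board (l.state r).1).getD (Entry.default hd))).1.last) } := by
  obtain ⟨M, hM, he⟩ := exists_exec_eq c u l r
  rw [he, namingCode, if_neg (mt hM.1 h), dif_pos hd]

theorem exec_of_deg_eq_zero (h : ¬ Conflict c u l r) (hd : ¬ 0 < N.deg u) : c.exec u l r =
    { board := l.board
      state := Function.update l.state r (l.state r)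
      out := Function.update l.out r none } := by
  obtain ⟨M, hM, he⟩ := exists_exec_eq c u l r
  rw [he, namingCode, if_neg (mt hM.1 h), dif_neg hd]

theorem exec_state_of_not_conflict (h : ¬ Conflict c u l r) :
    ((c.exec u l r).state r).1 = (l.state r).1 := by
  by_cases hd : 0 < N.deg u
  · rw [exec_of_not_conflict h hd]
    dsimp only
    rw [Function.update_self]
  · rw [exec_of_deg_eq_zero h hd]
    exact congrArg Prod.fst (Function.update_self _ _ _)

theorem exec_state_of_conflict (h : Conflict c u l r) :
    (c.exec u l r).state r = ((l.state r).1 + 1, .fresh) := by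
  rw [exec_of_conflict h]
  exact Function.update_self _ _ _

theorem exec_state_of_ne (h : x ≠ r) : (c.exec u l r).state x = l.state x :=
  Function.update_of_ne h _ _

theorem exec_out_of_ne (h : x ≠ r) : (c.exec u l r).out x = l.out x :=
  Function.update_of_ne h _ _

theorem exec_board_of_ne {i : Fin k} (h : (l.state r).1 ≠ i) :
    (c.exec u l r).board i = l.board i := by
  by_cases hc : Conflict c u l r
  · rw [exec_of_conflict hc]
  · by_cases hd : 0 < N.deg u
    · rw [exec_of_not_conflict hc hd]
      exact Function.update_of_ne h.symm _ _
    · rw [exec_of_deg_eq_zero hc hd]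

theorem foldl_state_of_notMem {L : List (Fin k)} (h : x ∉ L) :
    (L.foldl (c.exec u) l).state x = l.state x := by
  induction L generalizing l with
  | nil => rfl
  | cons r L ih =>
    rw [List.foldl_cons, ih (fun hx => h (List.mem_cons_of_mem _ hx)),
      exec_state_of_ne (fun hx => h (by simp [hx]))]

theorem foldl_out_of_notMem {L : List (Fin k)} (h : x ∉ L) :
    (L.foldl (c.exec u) l).out x = l.out x := by
  induction L generalizing l with
  | nil => rfl
  | cons r L ih =>
    rw [List.foldl_cons, ih (fun hx => h (List.mem_cons_of_mem _ hx)),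
      exec_out_of_ne (fun hx => h (by simp [hx]))]

theorem foldl_board {i : Fin k} {L : List (Fin k)} (hL : L.Nodup)
    (h : ∀ x ∈ L, (l.state x).1 ≠ i) : (L.foldl (c.exec u) l).board i = l.board i := by
  induction L generalizing l with
  | nil => rfl
  | cons r L ih =>
    obtain ⟨h1, h2⟩ := List.nodup_cons.1 hL
    rw [List.foldl_cons, ih h2, exec_board_of_ne (h r (by simp))]
    intro x hx
    rw [exec_state_of_ne (by rintro rfl; exact h1 hx)]
    exact h x (List.mem_cons_of_mem _ hx)

/-- An identifier that occurs on `u` is kept by somebody on `u`. -/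
theorem foldl_occupied {i : Fin k} {L : List (Fin k)}
    (h : ∃ x, c.pos x = u ∧ (l.state x).1 = i) :
    ∃ x, c.pos x = u ∧ ((L.foldl (c.exec u) l).state x).1 = i := by
  induction L generalizing l with
  | nil => exact h
  | cons r L ih =>
    refine ih ?_
    obtain ⟨x, hx, hi⟩ := h
    by_cases hxr : x = r
    · subst hxr
      by_cases hc : Conflict c u l x
      · obtain ⟨y, hy, hyx, -, hys⟩ := hc
        exact ⟨y, hy, by rw [exec_state_of_ne hyx, hys, hi]⟩
      · exact ⟨x, hx, by rw [exec_state_of_not_conflict hc, hi]⟩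
    · exact ⟨x, hx, by rw [exec_state_of_ne hxr, hi]⟩

theorem foldl_of_injective {L : List (Fin k)} (h : Function.Injective fun x => (l.state x).1)
    (x : Fin k) : ((L.foldl (c.exec u) l).state x).1 = (l.state x).1 := by
  induction L generalizing l with
  | nil => rfl
  | cons r L ih =>
    have key : ∀ y, ((c.exec u l r).state y).1 = (l.state y).1 := by
      intro y
      by_cases hyr : y = r
      · subst hyr
        refine exec_state_of_not_conflict ?_
        rintro ⟨z, -, hz, -, hzs⟩
        exact hz (h hzs)
      · rw [exec_state_of_ne hyr]
    rw [List.foldl_cons, ih, key]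
    rw [show (fun x => ((c.exec u l r).state x).1) = fun x => (l.state x).1 from funext key]
    exact h

end exec

section step

variable {V : Type*} {k : ℕ} [NeZero k] {N : Network V} {c : Config (naming k) N}
  {a : V → List (Fin k)} {u : V} {r s : Fin k}

theorem mem_act_iff (ha : c.Admissible a) (hu : a u ≠ []) : r ∈ a u ↔ c.pos r = u := by
  classical
  refine ⟨ha.mem u r, fun hr => ?_⟩
  have h0 : c.views u (a u) = c.views u (c.robotsAt u).val := ha.selected u hu
  have h1 := congrArg Multiset.card h0
  simp only [Config.views, Multiset.card_map, Multiset.coe_card] at h1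
  have h2 : (a u).toFinset = c.robotsAt u := by
    refine Finset.eq_of_subset_of_card_le ?_ ?_
    · intro x hx
      exact mem_robotsAt.2 (ha.mem u x (List.mem_toFinset.1 hx))
    · rw [List.toFinset_card_of_nodup (ha.nodup u), h1]
      rfl
  rw [← List.mem_toFinset, h2]
  exact mem_robotsAt.2 hr

theorem run_nil (h : a u = []) :
    c.run u (a u) = { board := c.board u, state := c.state, out := fun _ => none } := by
  rw [h]; rfl

theorem step_of_inactive (h : a (c.pos r) = []) : (c.step a).pos r = c.pos r ∧
    (c.step a).src r = c.src r ∧ (c.step a).state r = c.state r := by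
  simp only [Config.step, run_nil h, Option.elim_none, and_self]

theorem step_board_of_inactive (h : a u = []) : (c.step a).board u = c.board u := by
  simp only [Config.step, run_nil h]

/-- The execution of the robot `r` in the course of an activation of its node: before it, the robot
is as it was, and afterwards its state remains as it is then. -/
theorem exists_exec (ha : c.Admissible a) (hr : a (c.pos r) ≠ []) :
    ∃ pre post, a (c.pos r) = pre ++ r :: post ∧ (pre ++ r :: post).Nodup ∧
      ∃ l, l = pre.foldl (c.exec (c.pos r))
          { board := c.board (c.pos r), state := c.state, out := fun _ => none } ∧
        (∀ x ∉ pre, l.state x = c.state x ∧ l.out x = none) ∧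
        c.run (c.pos r) (a (c.pos r)) = post.foldl (c.exec (c.pos r)) (c.exec (c.pos r) l r) ∧
        (c.run (c.pos r) (a (c.pos r))).state r = (c.exec (c.pos r) l r).state r ∧
        (c.run (c.pos r) (a (c.pos r))).out r = (c.exec (c.pos r) l r).out r := by
  obtain ⟨pre, post, hL⟩ := List.append_of_mem ((mem_act_iff (r := r) ha hr).2 rfl)
  have hnd : (pre ++ r :: post).Nodup := hL ▸ ha.nodup _
  have hpost : r ∉ post := (List.nodup_cons.1 (List.nodup_append.1 hnd).2.1).1
  refine ⟨pre, post, hL, hnd, _, rfl, fun x hx =>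
    ⟨foldl_state_of_notMem hx, foldl_out_of_notMem hx⟩, ?_, ?_, ?_⟩
  · rw [hL, Config.run, List.foldl_append, List.foldl_cons]
  · rw [hL, Config.run, List.foldl_append, List.foldl_cons, foldl_state_of_notMem hpost]
  · rw [hL, Config.run, List.foldl_append, List.foldl_cons, foldl_out_of_notMem hpost]

theorem step_ident (ha : c.Admissible a) (r : Fin k) :
    ((c.step a).state r).1 = (c.state r).1 ∨
      ((c.step a).state r = ((c.state r).1 + 1, .fresh)) := by
  by_cases hr : a (c.pos r) = []
  · exact .inl (by rw [(step_of_inactive hr).2.2])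
  · obtain ⟨pre, post, -, hnd, l, -, hl, -, hs, -⟩ := exists_exec ha hr
    have hpre : r ∉ pre := fun h => (List.nodup_append.1 hnd).2.2 r h r (by simp) rfl
    change ((c.run (c.pos r) (a (c.pos r))).state r).1 = _ ∨
      (c.run (c.pos r) (a (c.pos r))).state r = _
    rw [hs]
    by_cases hc : Conflict c (c.pos r) l r
    · right
      rw [exec_state_of_conflict hc, (hl r hpre).1]
    · left
      rw [exec_state_of_not_conflict hc, (hl r hpre).1]

theorem step_occupied {i : Fin k} (h : ∃ r, (c.state r).1 = i) :
    ∃ r, ((c.step a).state r).1 = i := by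
  obtain ⟨r, hr⟩ := h
  obtain ⟨x, hx, hi⟩ := foldl_occupied (c := c) (u := c.pos r) (L := a (c.pos r))
    (l := { board := c.board (c.pos r), state := c.state, out := fun _ => none }) ⟨r, rfl, hr⟩
  refine ⟨x, ?_⟩
  change ((c.run (c.pos x) (a (c.pos x))).state x).1 = i
  rw [hx]
  exact hi

theorem step_of_injective (h : Function.Injective fun r => (c.state r).1) (r : Fin k) :
    ((c.step a).state r).1 = (c.state r).1 :=
  foldl_of_injective (l := { board := c.board (c.pos r), state := c.state, out := fun _ => none })
    h r

theorem add_one_ne (hk : 2 ≤ k) (i : Fin k) : i + 1 ≠ i := by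
  obtain ⟨k, rfl⟩ : ∃ j, k = j + 2 := ⟨k - 2, by omega⟩
  intro h
  have := add_eq_left.1 h
  exact absurd this (by simp)

/-- When two robots with the same identifier are on an activated node, one of them changes it. -/
theorem step_of_meet (hk : 2 ≤ k) (ha : c.Admissible a) (hu : a u ≠ []) (hrs : r ≠ s)
    (hr : c.pos r = u) (hs : c.pos s = u) (hi : (c.state r).1 = (c.state s).1) :
    ((c.step a).state r).1 ≠ (c.state r).1 ∨ ((c.step a).state s).1 ≠ (c.state s).1 := by
  subst hr
  -- the robot that is executed first sees the other one
  have key : ∀ r s : Fin k, a (c.pos r) ≠ [] → c.pos s = c.pos r → r ≠ s →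
      (c.state r).1 = (c.state s).1 → ∀ pre post, a (c.pos r) = pre ++ r :: post → s ∉ pre →
      ((c.step a).state r).1 ≠ (c.state r).1 := by
    intro r s hu hs hrs hi pre post hL hspre
    have hnd : (pre ++ r :: post).Nodup := hL ▸ ha.nodup _
    have hpost : r ∉ post := (List.nodup_cons.1 (List.nodup_append.1 hnd).2.1).1
    have hpre : r ∉ pre := fun h => (List.nodup_append.1 hnd).2.2 r h r (by simp) rfl
    change ((c.run (c.pos r) (a (c.pos r))).state r).1 ≠ _
    rw [hL, Config.run, List.foldl_append, List.foldl_cons, foldl_state_of_notMem hpost]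
    rw [exec_state_of_conflict ⟨s, hs, hrs.symm, foldl_out_of_notMem hspre, by
      rw [foldl_state_of_notMem hspre, foldl_state_of_notMem hpre]; exact hi.symm⟩]
    rw [foldl_state_of_notMem hpre]
    exact add_one_ne hk _
  obtain ⟨pre, post, hL⟩ := List.append_of_mem ((mem_act_iff (r := r) ha hu).2 rfl)
  by_cases hsp : s ∈ pre
  · right
    obtain ⟨pre', post', rfl⟩ := List.append_of_mem hsp
    refine key s r (by rwa [hs]) hs.symm hrs.symm hi.symm pre' (post' ++ r :: post)
      (by rw [hs, hL]; simp) fun h => ?_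
    have hnd : ((pre' ++ s :: post') ++ r :: post).Nodup := hL ▸ ha.nodup _
    exact (List.nodup_append.1 hnd).2.2 r (by simp [h]) r (by simp) rfl
  · exact .inl (key r s hu hs hrs hi pre post hL hsp)

/-- Nobody without the identifier `i` writes the entry of `i`. -/
theorem step_board {i : Fin k} (ha : c.Admissible a) (h : ∀ r, c.pos r = u → (c.state r).1 ≠ i) :
    (c.step a).board u i = c.board u i :=
  foldl_board (l := { board := c.board u, state := c.state, out := fun _ => none }) (ha.nodup u)
    fun x hx => h x (ha.mem u x hx)

/-- A robot that is executed and keeps its identifier moves according to `rule`, provided that no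
other robot on its node has the same identifier. -/
theorem step_of_keep (hk : 2 ≤ k) (ha : c.Admissible a) (hr : a (c.pos r) ≠ [])
    (hd : 0 < N.deg (c.pos r)) (hi : ((c.step a).state r).1 = (c.state r).1)
    (hone : ∀ s, c.pos s = c.pos r → (c.state s).1 = (c.state r).1 → s = r) :
    let res := rule nextPort (N.portTo (c.pos r) (c.src r)) (c.state r).2
      ((c.board (c.pos r) (c.state r).1).getD (Entry.default hd))
    (c.step a).pos r = N.neighbor (c.pos r) res.1.last ∧ (c.step a).src r = some (c.pos r) ∧
      (c.step a).state r = ((c.state r).1, res.2) ∧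
      (c.step a).board (c.pos r) (c.state r).1 = some res.1 := by
  obtain ⟨pre, post, hL, hnd, l, hl', hl, hrun, hs, ho⟩ := exists_exec ha hr
  have hpre : r ∉ pre := fun h => (List.nodup_append.1 hnd).2.2 r h r (by simp) rfl
  have hpost : r ∉ post := (List.nodup_cons.1 (List.nodup_append.1 hnd).2.1).1
  have hst := (hl r hpre).1
  have hc : ¬ Conflict c (c.pos r) l r := by
    intro hc
    change ((c.run (c.pos r) (a (c.pos r))).state r).1 = _ at hi
    rw [hs, exec_state_of_conflict hc, hst] at hi
    exact add_one_ne hk _ hi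
  have hother : ∀ x ∈ a (c.pos r), x ≠ r → (c.state x).1 ≠ (c.state r).1 :=
    fun x hx hxr he => hxr (hone x (ha.mem _ x hx) he)
  have hb : l.board (c.state r).1 = c.board (c.pos r) (c.state r).1 := by
    rw [hl']
    refine foldl_board (List.nodup_append.1 hnd).1 fun x hx => hother x ?_ ?_
    · rw [hL]; simp [hx]
    · rintro rfl; exact hpre hx
  have hex := exec_of_not_conflict hc hd
  rw [hst, hb] at hex
  intro res
  change c.exec (c.pos r) l r = Local.mk (Function.update l.board (c.state r).1 (some res.1))
    (Function.update l.state r ((c.state r).1, res.2))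
    (Function.update l.out r (some res.1.last)) at hex
  have ho' : (c.run (c.pos r) (a (c.pos r))).out r = some res.1.last := by
    rw [ho, hex]; exact Function.update_self _ _ _
  refine ⟨?_, ?_, ?_, ?_⟩
  · simp only [Config.step, ho', Option.elim_some]
  · simp only [Config.step, ho', Option.elim_some]
  · change (c.run (c.pos r) (a (c.pos r))).state r = _
    rw [hs, hex]; exact Function.update_self _ _ _
  · change (c.run (c.pos r) (a (c.pos r))).board _ = _
    rw [hrun, foldl_board (List.nodup_cons.1 (List.nodup_append.1 hnd).2.1).2, hex]
    · exact Function.update_self _ _ _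
    · intro x hx
      have hxr : x ≠ r := by rintro rfl; exact hpost hx
      have hxpre : x ∉ pre := fun h => (List.nodup_append.1 hnd).2.2 x h x (by simp [hx]) rfl
      rw [exec_state_of_ne hxr, (hl x hxpre).1]
      exact hother x (by rw [hL]; simp [hx]) hxr

end step

/-! ### Ports, rounds and executions -/

section network

variable {V : Type*} (N : Network V)

theorem neighbor_adj (u : V) (p : Fin (N.deg u)) : N.graph.Adj u (N.neighbor u p) :=
  ((N.port u).symm p).2

theorem neighbor_injective (u : V) : Function.Injective (N.neighbor u) :=
  Subtype.val_injective.comp (N.port u).symm.injective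

theorem neighbor_port {u w : V} (h : N.graph.Adj u w) : N.neighbor u (N.port u ⟨w, h⟩) = w := by
  simp [Network.neighbor]

theorem portTo_of_adj {u w : V} (h : N.graph.Adj u w) :
    N.portTo u (some w) = some (N.port u ⟨w, h⟩) := by
  unfold Network.portTo
  split
  · rename_i hex
    congr 2
    exact Subtype.ext (Option.some.inj hex.choose_spec).symm
  · rename_i hno
    exact absurd ⟨⟨w, h⟩, rfl⟩ hno

open Classical in
/-- The cyclic order that the port numbers induce on the neighbours of `x`. -/
noncomputable def nextNeighbor (x q : V) : V :=
  if h : N.graph.Adj x q then N.neighbor x (nextPort (N.port x ⟨q, h⟩)) else q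

theorem nextNeighbor_neighbor (x : V) (p : Fin (N.deg x)) :
    nextNeighbor N x (N.neighbor x p) = N.neighbor x (nextPort p) := by
  rw [nextNeighbor, dif_pos (neighbor_adj N x p)]
  congr 2
  apply neighbor_injective N x
  rw [neighbor_port]

theorem exists_neighbor_eq {x q : V} (h : N.graph.Adj x q) : ∃ p, N.neighbor x p = q :=
  ⟨_, neighbor_port N h⟩

theorem isRotation_nextNeighbor : N.graph.IsRotation (nextNeighbor N) where
  adj h := by
    obtain ⟨p, rfl⟩ := exists_neighbor_eq N h
    rw [nextNeighbor_neighbor]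
    exact neighbor_adj N _ _
  inj h h' he := by
    obtain ⟨p, rfl⟩ := exists_neighbor_eq N h
    obtain ⟨p', rfl⟩ := exists_neighbor_eq N h'
    rw [nextNeighbor_neighbor, nextNeighbor_neighbor] at he
    rw [nextPort_injective (neighbor_injective N _ he)]
  cyclic {x q p} h h' := by
    obtain ⟨a, rfl⟩ := exists_neighbor_eq N h
    obtain ⟨b, rfl⟩ := exists_neighbor_eq N h'
    obtain ⟨j, rfl⟩ := exists_iterate_nextPort a b
    refine ⟨j, ?_⟩
    induction j with
    | zero => rfl
    | succ j ih =>
      rw [Function.iterate_succ_apply', ih (neighbor_adj N _ _), nextNeighbor_neighbor,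
        Function.iterate_succ_apply']

theorem deg_pos [Finite V] [Nontrivial V] (h : N.graph.Connected) (u : V) : 0 < N.deg u := by
  obtain ⟨w, hw⟩ := h.preconnected.exists_adj_of_nontrivial u
  exact (Set.ncard_pos (Set.toFinite _)).2 ⟨w, hw⟩

end network

section execution

variable {V : Type*} {k : ℕ} [NeZero k] {N : Network V} (e : Execution (naming k) N)

/-- The identifier of a robot, counted from `0`. -/
def label (t : ℕ) (r : Fin k) : Fin k := ((e.config t).state r).1

variable {e}

theorem label_succ (t : ℕ) (r : Fin k) :
    label e (t + 1) r = label e t r ∨ label e (t + 1) r = label e t r + 1 := by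
  rw [label, e.step_eq]
  exact (step_ident (e.admissible t) r).imp id (congrArg Prod.fst)

theorem stay_of_inactive {t t' : ℕ} {r : Fin k} (htt : t ≤ t')
    (h : ∀ s, t ≤ s → s < t' → e.act s ((e.config t).pos r) = []) :
    (e.config t').pos r = (e.config t).pos r ∧ label e t' r = label e t r := by
  induction t', htt using Nat.le_induction with
  | base => exact ⟨rfl, rfl⟩
  | succ s hs ih =>
    obtain ⟨h1, h2⟩ := ih fun s' h1 h2 => h s' h1 (by omega)
    have h3 : e.act s ((e.config s).pos r) = [] := by rw [h1]; exact h s hs (by omega)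
    obtain ⟨k1, -, k3⟩ := step_of_inactive h3
    rw [label, e.step_eq, k1, k3]
    exact ⟨h1, h2⟩

/-- The first activation of the node of a robot. -/
theorem exists_first_act {t t' : ℕ} {r : Fin k}
    (h : ∃ s, t ≤ s ∧ s < t' ∧ e.act s ((e.config t).pos r) ≠ []) :
    ∃ s, t ≤ s ∧ s < t' ∧ e.act s ((e.config t).pos r) ≠ [] ∧
      ∀ s', t ≤ s' → s' < s → e.act s' ((e.config t).pos r) = [] := by
  classical
  refine ⟨Nat.find h, (Nat.find_spec h).1, (Nat.find_spec h).2.1, (Nat.find_spec h).2.2,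
    fun s' h1 h2 => ?_⟩
  have := Nat.find_min h h2
  push Not at this
  exact this h1 (h2.trans (Nat.find_spec h).2.1)

theorem exists_act (t : ℕ) (r : Fin k) : ∃ s, t ≤ s ∧ e.act s ((e.config t).pos r) ≠ [] := by
  by_contra! h
  obtain ⟨s, hs, hs'⟩ := e.weaklyFair ((e.config t).pos r) t
    fun t' ht' => ⟨r, (stay_of_inactive ht' fun s h1 _ => h s h1).1⟩
  exact hs' (h s hs)

variable (e) in
/-- `τ m` is the time at which the first `m` rounds are over. -/
def IsRounds (τ : ℕ → ℕ) : Prop := τ 0 = 0 ∧ ∀ m,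
  IsLeast {x | ∀ r, ∃ s, τ m ≤ s ∧ s < x ∧ e.act s ((e.config (τ m)).pos r) ≠ []} (τ (m + 1))

variable (e) in
theorem exists_isRounds : ∃ τ, IsRounds e τ := by
  have h : ∀ t, ∃ t',
      IsLeast {x | ∀ r, ∃ s, t ≤ s ∧ s < x ∧ e.act s ((e.config t).pos r) ≠ []} t' := by
    intro t
    choose s hs hs' using exists_act (e := e) t
    have hne : {x | ∀ r, ∃ s, t ≤ s ∧ s < x ∧ e.act s ((e.config t).pos r) ≠ []}.Nonempty :=
      ⟨Finset.univ.sup s + 1, fun r =>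
        ⟨s r, hs r, Nat.lt_succ_of_le (Finset.le_sup (Finset.mem_univ r)), hs' r⟩⟩
    exact ⟨_, Nat.sInf_mem hne, fun x hx => Nat.sInf_le hx⟩
  choose f hf using h
  refine ⟨fun m => f^[m] 0, rfl, fun m => ?_⟩
  have := hf (f^[m] 0)
  rwa [← Function.iterate_succ_apply' f] at this

theorem IsRounds.roundsEnd {τ : ℕ → ℕ} (h : IsRounds e τ) (m : ℕ) : e.RoundsEnd m (τ m) := by
  induction m with
  | zero => rw [h.1]; exact .zero
  | succ m ih => exact .succ ih (h.2 m)

theorem IsRounds.monotone {τ : ℕ → ℕ} (h : IsRounds e τ) : Monotone τ :=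
  monotone_nat_of_le_succ fun m => by
    obtain ⟨s, h1, h2, -⟩ := (h.2 m).1 0
    omega

/-- Every robot is executed in every round. -/
theorem IsRounds.exists_act {τ : ℕ → ℕ} (h : IsRounds e τ) (m : ℕ) (r : Fin k) :
    ∃ s, τ m ≤ s ∧ s < τ (m + 1) ∧ e.act s ((e.config s).pos r) ≠ [] := by
  obtain ⟨s, h1, h2, h3, h4⟩ := exists_first_act ((h.2 m).1 r)
  exact ⟨s, h1, h2, by rwa [(stay_of_inactive h1 h4).1]⟩

/-- Two robots with the same identifier that meet before round `m` is over are separated in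
round `m + 1` at the latest. -/
theorem IsRounds.exists_leave_of_meet (hk : 2 ≤ k) {τ : ℕ → ℕ} (h : IsRounds e τ) {t m : ℕ}
    (ht : t ≤ τ m) {r r' : Fin k} (hrr : r ≠ r') (hl : label e t r = label e t r')
    (hp : (e.config t).pos r = (e.config t).pos r') :
    ∃ s x, t ≤ s ∧ s < τ (m + 1) ∧ label e s x = label e t r ∧ label e (s + 1) x ≠ label e s x := by
  have hex : ∃ s, t ≤ s ∧ s < τ (m + 1) ∧ e.act s ((e.config t).pos r) ≠ [] := by
    by_contra! hno
    have hm := h.monotone (Nat.le_succ m)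
    have := (stay_of_inactive ht fun s h1 h2 => hno s h1 (h2.trans_le hm)).1
    obtain ⟨s, h1, h2, h3⟩ := (h.2 m).1 r
    rw [this] at h3
    exact h3 (hno s (by omega) h2)
  obtain ⟨s, h1, h2, h3, h4⟩ := exists_first_act hex
  obtain ⟨k1, k2⟩ := stay_of_inactive h1 h4
  rw [hp] at h4
  obtain ⟨k3, k4⟩ := stay_of_inactive h1 h4
  have := step_of_meet hk (e.admissible s) h3 hrr k1 (k3.trans hp.symm)
    (k2.trans (hl.trans k4.symm))
  rw [← e.step_eq] at this
  rcases this with h5 | h5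
  · exact ⟨s, r, h1, h2, k2, h5⟩
  · exact ⟨s, r', h1, h2, k4.trans hl.symm, h5⟩

/-- The robots with the identifier `i`, from the time `t₀` on, during a time in which nobody gives
up this identifier and no two robots with this identifier meet. -/
noncomputable def tokenRun (hk : 2 ≤ k) (hd : ∀ u, 0 < N.deg u) (e : Execution (naming k) N)
    (i : Fin k) (t₀ T : ℕ)
    (hkeep : ∀ t < T, ∀ r, label e (t₀ + t) r = i → label e (t₀ + t + 1) r = i)
    (hmeet : ∀ t ≤ T, ∀ r r', label e (t₀ + t) r = i → label e (t₀ + t) r' = i →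
      (e.config (t₀ + t)).pos r = (e.config (t₀ + t)).pos r' → r = r') :
    TokenRun N.graph (nextNeighbor N) (Fin k) T where
  tok t r := label e (t₀ + t) r = i
  pos t r := (e.config (t₀ + t)).pos r
  src t r := (N.portTo ((e.config (t₀ + t)).pos r) ((e.config (t₀ + t)).src r)).map (N.neighbor _)
  mode t r := ((e.config (t₀ + t)).state r).2
  ent t u := (((e.config (t₀ + t)).board u i).getD (Entry.default (hd u))).map (N.neighbor u)
  last_adj t u := neighbor_adj N _ _
  ret_adj t u := neighbor_adj N _ _
  src_adj t r w h := by
    obtain ⟨p, -, rfl⟩ := Option.map_eq_some_iff.1 h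
    exact neighbor_adj N _ _
  tok_succ := hkeep
  step t ht r hr := by
    have hstep := e.step_eq (t₀ + t)
    have hadm := e.admissible (t₀ + t)
    have hl : ((e.config (t₀ + t)).state r).1 = i := hr
    by_cases ha : e.act (t₀ + t) ((e.config (t₀ + t)).pos r) = []
    · left
      obtain ⟨k1, k2, k3⟩ := step_of_inactive ha
      have k4 := step_board_of_inactive (c := e.config (t₀ + t)) ha
      rw [← add_assoc, hstep, k1, k2, k3, k4]
      exact ⟨rfl, rfl, rfl, rfl⟩
    · right
      have hi : (((e.config (t₀ + t)).step (e.act (t₀ + t))).state r).1 =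
          ((e.config (t₀ + t)).state r).1 := by
        rw [← hstep]
        exact (hkeep t ht r hr).trans hr.symm
      obtain ⟨k1, k2, k3, k4⟩ := step_of_keep hk hadm ha (hd _) hi fun s h1 h2 =>
        hmeet t ht.le s r (h2.trans hl) hl h1
      rw [hl] at k1 k3 k4
      rw [← add_assoc, hstep, k1, k2, k3, k4, rule_map (neighbor_injective N _)
        (nextNeighbor_neighbor N _), portTo_of_adj N (neighbor_adj N _ _).symm, Option.map_some,
        neighbor_port]
      exact ⟨rfl, rfl, rfl, rfl⟩
  mode_of_join t ht r h1 h2 := by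
    have := step_ident (e.admissible (t₀ + t)) r
    rw [← e.step_eq] at this
    rcases this with h | h
    · exact absurd (h.symm.trans h2) h1
    · exact congrArg Prod.snd h
  ent_succ t ht u h := by
    rw [← add_assoc, e.step_eq, step_board (e.admissible (t₀ + t)) fun r hr hi => h r hi hr]
  no_swap t ht r r' _ _ h1 h2 := by
    rw [← add_assoc, e.step_eq] at h1 h2
    exact (e.admissible (t₀ + t)).semiBidirectional r r' h1 h2
  no_meet := hmeet

/-- Of two robots with the same identifier in a tree, one gives it up within `10n` rounds. -/
theorem IsRounds.exists_leave [Fintype V] (hk : 2 ≤ k) (hN : N.graph.IsTree) {τ : ℕ → ℕ}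
    (hτ : IsRounds e τ) (m₀ : ℕ) {A B : Fin k} (hAB : A ≠ B)
    (hl : label e (τ m₀) A = label e (τ m₀) B) :
    ∃ t x, τ m₀ ≤ t ∧ t < τ (m₀ + 10 * Fintype.card V) ∧ label e t x = label e (τ m₀) A ∧
      label e (t + 1) x ≠ label e t x := by
  by_contra! hno
  have hn : 0 < Fintype.card V := Fintype.card_pos_iff.2 ⟨(e.config 0).pos A⟩
  have hmono := hτ.monotone
  set n := Fintype.card V
  set i := label e (τ m₀) A
  -- a meeting within `7n + 2` rounds has an effect in the next round, and `7n + 3 ≤ 10n`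
  obtain ⟨T, hT⟩ : ∃ T, τ (m₀ + (7 * n + 2)) = τ m₀ + T :=
    ⟨_, (Nat.add_sub_of_le (hmono (by omega))).symm⟩
  have hend : τ (m₀ + (7 * n + 2) + 1) ≤ τ (m₀ + 10 * n) := hmono (by omega)
  have hend' : τ (m₀ + (7 * n + 2)) ≤ τ (m₀ + (7 * n + 2) + 1) := hmono (Nat.le_succ _)
  have hkeep : ∀ t < T, ∀ r, label e (τ m₀ + t) r = i → label e (τ m₀ + t + 1) r = i :=
    fun t ht r hr => (hno _ r (by omega) (by omega) hr).trans hr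
  have hmeet : ∀ t ≤ T, ∀ r r', label e (τ m₀ + t) r = i → label e (τ m₀ + t) r' = i →
      (e.config (τ m₀ + t)).pos r = (e.config (τ m₀ + t)).pos r' → r = r' := by
    intro t ht r r' hr hr' hp
    by_contra hrr
    obtain ⟨s, x, h1, h2, h3, h4⟩ :=
      hτ.exists_leave_of_meet hk (m := m₀ + (7 * n + 2)) (by omega) hrr (hr.trans hr'.symm) hp
    exact h4 (hno s x (by omega) (by omega) (h3.trans hr))
  rcases subsingleton_or_nontrivial V with hV | hV
  · exact hAB (hmeet 0 (Nat.zero_le _) A B rfl hl.symm (Subsingleton.elim _ _))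
  · have hd := deg_pos N hN.connected
    let R := tokenRun hk hd e i (τ m₀) T hkeep hmeet
    have hsub : ∀ l, τ m₀ + (τ (m₀ + l) - τ m₀) = τ (m₀ + l) := fun l =>
      Nat.add_sub_of_le (hmono (by omega))
    refine R.not_two_tokens hN (isRotation_nextNeighbor N) (τ := fun l => τ (m₀ + l) - τ m₀)
      (fun a b hab => Nat.sub_le_sub_right (hmono (by omega)) _)
      (by change τ (m₀ + (7 * n + 2)) - τ m₀ ≤ T; omega) ?_ (A := A) (B := B)
      ?_ ?_ hAB
    · intro l hlt r hr
      obtain ⟨s, h1, h2, h3⟩ := hτ.exists_act (m₀ + l) r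
      have h4 := hmono (show m₀ ≤ m₀ + l by omega)
      have h5 := hmono (show m₀ + l + 1 ≤ m₀ + (7 * n + 2) by omega)
      obtain ⟨t, rfl⟩ : ∃ t, s = τ m₀ + t := ⟨_, (Nat.add_sub_of_le (h4.trans h1)).symm⟩
      have htT : t < T := by omega
      have hrt : R.tok t r := TokenRun.tok_of_le hr (by omega) htT.le
      refine ⟨t, by omega, by rw [← add_assoc]; omega, ?_⟩
      have hi : (((e.config (τ m₀ + t)).step (e.act (τ m₀ + t))).state r).1 =
          ((e.config (τ m₀ + t)).state r).1 := by
        rw [← e.step_eq]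
        exact (hkeep t htT r hrt).trans hrt.symm
      obtain ⟨k1, -⟩ := step_of_keep hk (e.admissible _) h3 (hd _) hi fun s h1 h2 =>
        hmeet t htT.le s r (h2.trans hrt) hrt h1
      change (e.config (τ m₀ + t + 1)).pos r ≠ (e.config (τ m₀ + t)).pos r
      rw [e.step_eq, k1]
      exact (neighbor_adj N _ _).ne'
    · change label e (τ m₀ + (τ (m₀ + 0) - τ m₀)) A = i
      rw [hsub]; rfl
    · change label e (τ m₀ + (τ (m₀ + 0) - τ m₀)) B = i
      rw [hsub]; exact hl.symm

end execution

/-! ### Parking, and the size of the memory -/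

theorem val_add_one {k : ℕ} [NeZero k] (hk : 2 ≤ k) {x : Fin k} (h : x + 1 ≠ 0) :
    (x + 1).val = x.val + 1 := by
  have h1 : (1 : Fin k).val = 1 := by rw [Fin.val_one', Nat.mod_eq_of_lt hk]
  have h2 : (x + 1).val = (x.val + 1) % k := by rw [Fin.val_add, h1]
  rcases Nat.lt_or_ge (x.val + 1) k with h3 | h3
  · rw [h2, Nat.mod_eq_of_lt h3]
  · have h4 : x.val + 1 = k := by have := x.2; omega
    refine absurd (Fin.ext ?_) h
    rw [h2, h4, Nat.mod_self]; rfl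

/-- Parking `k` cars on a cycle of `k` places: if cars only advance by one place at a time and
every place that holds two cars at the beginning of a phase is left by a car in this phase, then
each place `h` is reached within `2k` phases.

Otherwise, no car passes `h`. Let `N j` be the number of cars on the `j` places that follow `h`.
Its excess over `j` drops in each phase in which it is greater than the excess of `N (j - 1)`. As
the excesses are at most `k` at the beginning, `N j` is at most `j` after `k + j` phases, which is
absurd for `j = k - 1`. -/
theorem exists_parked {k : ℕ} [NeZero k] (hk : 2 ≤ k) {f : ℕ → Fin k → Fin k}
    (hstep : ∀ t r, f (t + 1) r = f t r ∨ f (t + 1) r = f t r + 1) {S : ℕ → ℕ} (hS : Monotone S)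
    (hleave : ∀ p A B, A ≠ B → f (S p) A = f (S p) B →
      ∃ t x, S p ≤ t ∧ t < S (p + 1) ∧ f t x = f (S p) A ∧ f (t + 1) x ≠ f t x) (h : Fin k) :
    ∃ t ≤ S (2 * k), ∃ r, f t r = h := by
  by_contra! hno
  let v : ℕ → Fin k → ℕ := fun t r => (f t r - h).val
  have hv : ∀ t < S (2 * k), ∀ r, v (t + 1) r = v t r ∧ f (t + 1) r = f t r ∨
      v (t + 1) r = v t r + 1 := by
    intro t ht r
    rcases hstep t r with h1 | h1
    · exact .inl ⟨by simp only [v, h1], h1⟩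
    · right
      have h2 : f (t + 1) r - h = f t r - h + 1 := by rw [h1]; abel
      simp only [v, h2]
      exact val_add_one hk (by rw [← h2]; exact sub_ne_zero.2 (hno (t + 1) ht r))
  let N : ℕ → ℕ → ℕ := fun j t => (Finset.univ.filter fun r => v t r ≤ j).card
  have hN1 : ∀ j t, t < S (2 * k) → N j (t + 1) ≤ N j t := by
    intro j t ht
    refine Finset.card_le_card fun r hr => ?_
    simp only [Finset.mem_filter, Finset.mem_univ, true_and] at hr ⊢
    rcases hv t ht r with h1 | h1 <;> omega
  have hN : ∀ j t t', t ≤ t' → t' ≤ S (2 * k) → N j t' ≤ N j t := by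
    intro j t t' htt
    induction t', htt using Nat.le_induction with
    | base => exact fun _ => le_rfl
    | succ s _ ih => exact fun hs => (hN1 j s (by omega)).trans (ih (by omega))
  have hNk : ∀ j t, N j t ≤ k := fun j t => by
    simpa using Finset.card_filter_le (Finset.univ : Finset (Fin k)) fun r => v t r ≤ j
  have hN0 : ∀ t ≤ S (2 * k), N 0 t = 0 := by
    intro t ht
    refine Finset.card_eq_zero.2 (Finset.filter_eq_empty_iff.2 fun r _ hr => ?_)
    refine sub_ne_zero.2 (hno t ht r) (Fin.ext ?_)
    simpa [v] using hr
  have hNlast : ∀ t, N (k - 1) t = k := by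
    intro t
    have : (Finset.univ.filter fun r => v t r ≤ k - 1) = (Finset.univ : Finset (Fin k)) :=
      Finset.filter_true_of_mem fun r _ => by
        have := (f t r - h).2
        simp only [v]; omega
    simp [N, this]
  -- a place with two cars is left
  have hdrop : ∀ j p, p < 2 * k → N j (S p) + 2 ≤ N (j + 1) (S p) →
      N (j + 1) (S (p + 1)) < N (j + 1) (S p) := by
    intro j p hp hle
    have hsplit : N (j + 1) (S p) =
        N j (S p) + (Finset.univ.filter fun r => v (S p) r = j + 1).card := by
      simp only [N]
      rw [← Finset.card_union_of_disjoint]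
      · congr 1
        ext r
        simp only [Finset.mem_filter, Finset.mem_univ, true_and, Finset.mem_union]
        omega
      · refine Finset.disjoint_left.2 fun r h1 h2 => ?_
        simp only [Finset.mem_filter, Finset.mem_univ, true_and] at h1 h2
        omega
    obtain ⟨A, hA, B, hB, hAB⟩ := Finset.one_lt_card.1
      (show 1 < (Finset.univ.filter fun r => v (S p) r = j + 1).card by omega)
    simp only [Finset.mem_filter, Finset.mem_univ, true_and] at hA hB
    have hf : f (S p) A = f (S p) B := by
      have : f (S p) A - h = f (S p) B - h := Fin.ext (hA.trans hB.symm)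
      exact sub_left_inj.1 this
    obtain ⟨t, x, h1, h2, h3, h4⟩ := hleave p A B hAB hf
    have hend : S (p + 1) ≤ S (2 * k) := hS (by omega)
    have hlt : N (j + 1) (t + 1) < N (j + 1) t := by
      have hx : v t x = j + 1 := by simp only [v, h3]; exact hA
      have hx1 : v (t + 1) x = j + 2 := by
        rcases hv t (by omega) x with h5 | h5
        · exact absurd h5.2 h4
        · omega
      refine Finset.card_lt_card ((Finset.ssubset_iff_of_subset fun r hr => ?_).2 ⟨x, ?_, ?_⟩)
      · simp only [Finset.mem_filter, Finset.mem_univ, true_and] at hr ⊢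
        rcases hv t (by omega) r with h1 | h1 <;> omega
      · simp only [Finset.mem_filter, Finset.mem_univ, true_and]; omega
      · simp only [Finset.mem_filter, Finset.mem_univ, true_and]; omega
    have h5 := hN (j + 1) (S p) t h1 (by omega)
    have h6 := hN (j + 1) (t + 1) (S (p + 1)) h2 hend
    omega
  have key : ∀ p ≤ 2 * k, ∀ j, N j (S p) ≤ j ∨ N j (S p) + p ≤ k + 2 * j := by
    intro p
    induction p with
    | zero =>
      intro _ j
      have := hNk j (S 0)
      omega
    | succ p ih =>
      intro hp j
      obtain _ | j := j
      · exact .inl (hN0 _ (hS hp)).le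
      · have h1 := ih (by omega) j
        have h2 := ih (by omega) (j + 1)
        have h3 := hN (j + 1) (S p) (S (p + 1)) (hS (Nat.le_succ p)) (hS hp)
        by_cases hle : N j (S p) + 2 ≤ N (j + 1) (S p)
        · have := hdrop j p (by omega) hle
          omega
        · omega
  have := key (2 * k) le_rfl (k - 1)
  rw [hNlast] at this
  omega

section execution

variable {V : Type*} {k : ℕ} [NeZero k] {N : Network V} {e : Execution (naming k) N}

theorem label_occupied {t t' : ℕ} (htt : t ≤ t') {i : Fin k} (h : ∃ r, label e t r = i) :
    ∃ r, label e t' r = i := by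
  induction t', htt using Nat.le_induction with
  | base => exact h
  | succ s _ ih =>
    have := step_occupied (a := e.act s) ih
    rwa [← e.step_eq] at this

theorem label_eq_of_injective {t t' : ℕ} (htt : t ≤ t') (h : Function.Injective (label e t)) :
    label e t' = label e t := by
  induction t', htt using Nat.le_induction with
  | base => rfl
  | succ s _ ih =>
    refine Eq.trans (funext fun r => ?_) ih
    have := step_of_injective (c := e.config s) (a := e.act s) (ih ▸ h :) r
    rwa [← e.step_eq] at this

theorem IsRounds.label_injective [Fintype V] (hk : 2 ≤ k) (hN : N.graph.IsTree) {τ : ℕ → ℕ}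
    (hτ : IsRounds e τ) :
    Function.Injective (label e (τ (2 * k * (10 * Fintype.card V)))) := by
  refine Finite.injective_iff_surjective.2 fun h => ?_
  obtain ⟨t, ht, hr⟩ := exists_parked hk (f := label e) label_succ
    (S := fun p => τ (p * (10 * Fintype.card V)))
    (fun a b hab => hτ.monotone (Nat.mul_le_mul_right _ hab))
    (fun p A B hAB hl => by
      obtain ⟨t, x, h1, h2, h3⟩ := hτ.exists_leave hk hN (p * (10 * Fintype.card V)) hAB hl
      exact ⟨t, x, h1, by rwa [Nat.succ_mul], h3⟩) h
  exact label_occupied ht hr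

end execution

theorem fitsInBits_state {k : ℕ} (hk : 2 ≤ k) : FitsInBits (Fin k × Mode) (20 * Nat.clog 2 k) := by
  refine ⟨inferInstance, ?_⟩
  have h1 : k ≤ 2 ^ Nat.clog 2 k := Nat.le_pow_clog (by norm_num) k
  have h2 : 0 < Nat.clog 2 k := Nat.clog_pos (by norm_num) hk
  rw [Nat.card_eq_fintype_card, Fintype.card_prod, Fintype.card_fin, card_mode]
  calc k * 4 ≤ 2 ^ Nat.clog 2 k * 2 ^ 2 := Nat.mul_le_mul h1 le_rfl
    _ = 2 ^ (Nat.clog 2 k + 2) := (pow_add _ _ _).symm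
    _ ≤ 2 ^ (20 * Nat.clog 2 k) := Nat.pow_le_pow_right (by norm_num) (by omega)

/-- Entries are triples. -/
def entryEquiv (P : Type*) : Entry P ≃ P × P × Bool where
  toFun E := (E.last, E.ret, E.start)
  invFun x := ⟨x.1, x.2.1, x.2.2⟩
  left_inv _ := rfl
  right_inv _ := rfl

theorem fitsInBits_board {k d Δ : ℕ} (hk : 2 ≤ k) (hd : d ≤ Δ) :
    FitsInBits (Fin k → Option (Entry (Fin d))) (20 * (k * (Nat.clog 2 k + Nat.clog 2 Δ))) := by
  have : Fintype (Entry (Fin d)) := Fintype.ofEquiv _ (entryEquiv (Fin d)).symm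
  have hc : Fintype.card (Entry (Fin d)) = d * (d * 2) := by
    rw [Fintype.card_congr (entryEquiv (Fin d))]; simp
  refine ⟨inferInstance, ?_⟩
  have h2 : 0 < Nat.clog 2 k := Nat.clog_pos (by norm_num) hk
  have h3 : d ≤ 2 ^ Nat.clog 2 Δ := hd.trans (Nat.le_pow_clog (by norm_num) Δ)
  have h4 : Fintype.card (Option (Entry (Fin d))) ≤ 2 ^ (2 * Nat.clog 2 Δ + 2) := by
    have h5 : 0 < 2 ^ Nat.clog 2 Δ := by positivity
    have h6 := Nat.mul_le_mul h3 h3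
    have h7 := Nat.mul_pos h5 h5
    rw [Fintype.card_option, hc, pow_add, two_mul (Nat.clog 2 Δ), pow_add]
    nlinarith
  rw [Nat.card_eq_fintype_card, Fintype.card_fun, Fintype.card_fin]
  calc _ ≤ (2 ^ (2 * Nat.clog 2 Δ + 2)) ^ k := Nat.pow_le_pow_left h4 k
    _ = 2 ^ ((2 * Nat.clog 2 Δ + 2) * k) := (pow_mul _ _ _).symm
    _ ≤ _ := Nat.pow_le_pow_right (by norm_num) ?_
  calc (2 * Nat.clog 2 Δ + 2) * k ≤ (20 * (Nat.clog 2 k + Nat.clog 2 Δ)) * k :=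
        Nat.mul_le_mul_right _ (by omega)
    _ = _ := by ring

theorem deg_le_maxDeg {V : Type*} [Fintype V] (N : Network V) (u : V) : N.deg u ≤ N.maxDeg :=
  Finset.le_sup (f := N.deg) (Finset.mem_univ u)

/-- The algorithm for a single robot, which never does anything. -/
def idle : RobotAlgorithm 1 where
  State := Unit
  Board _ := Unit
  state_nonempty := ⟨()⟩
  board_nonempty _ := ⟨()⟩
  ident _ := 1
  ident_mem _ := by simp
  code b s _ _ := (b, s, none)
  select _ := id
  select_le _ _ := le_rfl
  select_ne_zero _ _ h := h

theorem fitsInBits_unit (b : ℕ) : FitsInBits Unit b :=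
  ⟨inferInstance, by simpa using Nat.one_le_two_pow⟩

end TreeNaming

open TreeNaming in
theorem mainTheorem2 :
    ∃ C : ℕ, ∀ k : ℕ, 0 < k → ∃ A : RobotAlgorithm k,
      FitsInBits A.State (C * Nat.clog 2 k) ∧
      ∀ (V : Type*) [Fintype V] (N : Network V), N.graph.IsTree →
        (∀ u : V, FitsInBits (A.Board (N.deg u))
          (C * (k * (Nat.clog 2 k + Nat.clog 2 N.maxDeg)))) ∧
        ∀ e : A.Execution N,
          ∃ m ≤ C * (k * Fintype.card V), ∃ T : ℕ, e.RoundsEnd m T ∧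
            ∀ t ≥ T, e.Naming t ∧ e.ident t = e.ident T := by
  refine ⟨20, fun k hk => ?_⟩
  obtain rfl | hk : k = 1 ∨ 2 ≤ k := by omega
  · refine ⟨idle, fitsInBits_unit _, fun V _ N _ => ⟨fun u => fitsInBits_unit _, fun e => ?_⟩⟩
    exact ⟨0, Nat.zero_le _, 0, .zero, fun t _ =>
      ⟨⟨Function.injective_of_subsingleton _, fun r => idle.ident_mem _⟩, rfl⟩⟩
  · have : NeZero k := ⟨by omega⟩
    refine ⟨naming k, fitsInBits_state hk, fun V _ N hN =>
      ⟨fun u => fitsInBits_board hk (deg_le_maxDeg N u), fun e => ?_⟩⟩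
    obtain ⟨τ, hτ⟩ := exists_isRounds e
    have hinj := hτ.label_injective hk hN
    refine ⟨_, ?_, _, hτ.roundsEnd (2 * k * (10 * Fintype.card V)), fun t ht => ?_⟩
    · exact (by ring : 2 * k * (10 * Fintype.card V) = 20 * (k * Fintype.card V)).le
    · have hl := label_eq_of_injective ht hinj
      have hident : ∀ t r, e.ident t r = (label e t r : ℕ) + 1 := fun _ _ => rfl
      refine ⟨⟨fun r s hrs => ?_, fun r => (naming k).ident_mem _⟩, funext fun r => ?_⟩
      · rw [hident, hident, hl] at hrs
        exact hinj (Fin.ext (Nat.succ_injective hrs))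
      · rw [hident, hident, hl]
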